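/- **Conventions.** A weakness is an element of $\mathcal W=\{s,p,l,c\}$ (strict, pseudo, lax, colax), partially ordered by $s\le p$, $p\le l$, $p\le c$; the involution $\overline{(-)}$ fixes $s,p$ and exchanges $l,c$. For 1-cells $f,g$ of a 2-category, an $l$-cell from $f$ to $g$ is a 2-cell $f\Rightarrow g$, a $c$-cell a 2-cell $g\Rightarrow f$, a $p$-cell an invertible 2-cell between them, an $s$-cell an identity. A $w$-cell in a square $r\circ t,\ b\circ l$ (top $t$, right $r$, left $l$, bottom $b$) is a $w$-cell from $r\circ t$ to $b\circ l$. $\mathscr F$ is the cartesian closed category of full embeddings $A_\tau\hookrightarrow A_\lambda$ (fully faithful, injective-on-objects functors) of small categories. An $\mathscr F$-category is a category enriched in $\mathscr F$: a 2-category, whose 1-cells are called loose, with a wide and locally full sub-2-category of tight 1-cells; an $\mathscr F$-functor is a 2-functor preserving tightness. An $\mathscr F$-sketch $\mathcal S$ is a small $\mathscr F$-category $\mathbb S$ with a class of $\mathscr F$-weighted cones $(W\colon\mathbb J\to\mathbb F,\ D\colon\mathbb J\to\mathbb S,\ X\in\mathbb S,\ \gamma\colon W\Rightarrow\mathbb S(X,D-))$,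 with $\mathbb J$ small and $\gamma$ $\mathscr F$-natural, where $\mathbb F$ is $\mathscr F$ regarded as an $\mathscr F$-category. A model of $\mathcal S$ in an $\mathscr F$-sketch $\mathcal C$, equivalently a morphism $\mathcal S\to\mathcal C$ of $\mathscr F$-sketches, is an $\mathscr F$-functor $\mathbb S\to\mathbb C$ sending the cones of $\mathcal S$ to cones of $\mathcal C$. For weaknesses $w'\le w$, the $\mathscr F$-sketch $\mathrm{Mod}_{w',w}(\mathcal S,\mathcal C)$ is defined as follows. * Objects: the models of $\mathcal S$ in $\mathcal C$. * Loose morphisms $\phi\colon M\to N$: $w$-natural transformations, with loose components $\phi_S\colon M(S)\to N(S)$ and $w$-cells $\phi_s$ in the naturality squares (top $\phi_S$, right $N(s)$, left $M(s)$, bottom $\phi_{S'}$), such that $\phi_s$ is a $w'$-cell whenever $s$ is tight. * $\phi$ is tight when every $\phi_S$ is tight and every $\phi_s$ is a $w'$-cell. The 2-cells are the modifications. * Its cones are the weighted cones whose image under each evaluation $\mathscr F$-functor $M\mapsto M(S)$, $S\in\mathbb S$, is a cone of $\mathcal C$. **Proposition (Mod-skew-symmetry).** Let $w'\le w$ be weaknesses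 and let $\mathcal S,\mathcal T,\mathcal C$ be $\mathscr F$-sketches. There is an isomorphism of $\mathscr F$-sketches $$\mathrm{Mod}_{w',w}\bigl(\mathcal S,\mathrm{Mod}_{\overline{w'},\overline w}(\mathcal T,\mathcal C)\bigr)\;\cong\;\mathrm{Mod}_{\overline{w'},\overline w}\bigl(\mathcal T,\mathrm{Mod}_{w',w}(\mathcal S,\mathcal C)\bigr).$$ -/

import Mathlib

open CategoryTheory Bicategory

namespace Enhanced

universe w v u w₁ v₁ u₁ w₂ v₂ u₂ w₃ v₃ u₃

/-! ## Weaknesses and cells -/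

/-- The set of weaknesses: strict, pseudo, lax and colax. -/
inductive Weakness : Type
  | strict
  | pseudo
  | lax
  | colax

namespace Weakness

/-- The order with `strict ≤ pseudo`, `pseudo ≤ lax` and `pseudo ≤ colax`. -/
protected def le : Weakness → Weakness → Prop
  | strict, _ => True
  | pseudo, strict => False
  | pseudo, _ => True
  | lax, lax => True
  | lax, _ => False
  | colax, colax => True
  | colax, _ => False

instance : PartialOrder Weakness where
  le := Weakness.le
  le_refl a := by cases a <;> trivial
  le_trans a b c h h' := by cases a <;> cases b <;> cases c <;> trivial
  le_antisymm a b h h' := by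
    cases a <;> cases b <;> first | rfl | exact h.elim | exact h'.elim

/-- The involution exchanging `lax` and `colax`. -/
def bar : Weakness → Weakness
  | strict => strict
  | pseudo => pseudo
  | lax => colax
  | colax => lax

theorem bar_mono {a b : Weakness} (h : a ≤ b) : a.bar ≤ b.bar := by
  cases a <;> cases b <;> trivial

theorem ne_colax {a b : Weakness} (h : a ≤ b) (hb : b ≠ colax) : a ≠ colax := by
  rintro rfl
  cases b <;> first | exact hb rfl | exact h.elim

theorem ne_lax {a b : Weakness} (h : a ≤ b) (hb : b ≠ lax) : a ≠ lax := by
  rintro rfl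
  cases b <;> first | exact hb rfl | exact h.elim

theorem eq_strict {a b : Weakness} (h : a ≤ b) (hb : b = strict) : a = strict := by
  subst hb
  cases a <;> first | rfl | exact h.elim

end Weakness

section Strict

variable {B : Type u} [Bicategory.{w, v} B] [Bicategory.Strict B]

theorem assoc_hom_eq {a b c d : B} (f : a ⟶ b) (g : b ⟶ c) (h : c ⟶ d) :
    (α_ f g h).hom = eqToHom (Bicategory.Strict.assoc f g h) := by
  rw [Bicategory.Strict.associator_eqToIso]; rfl

theorem assoc_inv_eq {a b c d : B} (f : a ⟶ b) (g : b ⟶ c) (h : c ⟶ d) :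
    (α_ f g h).inv = eqToHom (Bicategory.Strict.assoc f g h).symm := by
  rw [Bicategory.Strict.associator_eqToIso]; rfl

theorem leftUnitor_hom_eq {a b : B} (f : a ⟶ b) :
    (λ_ f).hom = eqToHom (Bicategory.Strict.id_comp f) := by
  rw [Bicategory.Strict.leftUnitor_eqToIso]; rfl

theorem leftUnitor_inv_eq {a b : B} (f : a ⟶ b) :
    (λ_ f).inv = eqToHom (Bicategory.Strict.id_comp f).symm := by
  rw [Bicategory.Strict.leftUnitor_eqToIso]; rfl

theorem rightUnitor_hom_eq {a b : B} (f : a ⟶ b) :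
    (ρ_ f).hom = eqToHom (Bicategory.Strict.comp_id f) := by
  rw [Bicategory.Strict.rightUnitor_eqToIso]; rfl

theorem rightUnitor_inv_eq {a b : B} (f : a ⟶ b) :
    (ρ_ f).inv = eqToHom (Bicategory.Strict.comp_id f).symm := by
  rw [Bicategory.Strict.rightUnitor_eqToIso]; rfl

theorem conj_id_left {a b : B} {f g : a ⟶ b} (η : f ⟶ g) :
    𝟙 a ◁ η = eqToHom (Bicategory.Strict.id_comp f) ≫ η ≫
      eqToHom (Bicategory.Strict.id_comp g).symm := by
  rw [id_whiskerLeft, leftUnitor_hom_eq, leftUnitor_inv_eq]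

theorem conj_id_right {a b : B} {f g : a ⟶ b} (η : f ⟶ g) :
    η ▷ 𝟙 b = eqToHom (Bicategory.Strict.comp_id f) ≫ η ≫
      eqToHom (Bicategory.Strict.comp_id g).symm := by
  rw [whiskerRight_id, rightUnitor_hom_eq, rightUnitor_inv_eq]

theorem conj_comp_left {a b c d : B} (f : a ⟶ b) (g : b ⟶ c) {h h' : c ⟶ d} (η : h ⟶ h') :
    (f ≫ g) ◁ η = eqToHom (Bicategory.Strict.assoc f g h) ≫ f ◁ g ◁ η ≫
      eqToHom (Bicategory.Strict.assoc f g h').symm := by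
  rw [comp_whiskerLeft, assoc_hom_eq, assoc_inv_eq]

theorem conj_comp_right {a b c d : B} {f f' : a ⟶ b} (η : f ⟶ f') (g : b ⟶ c) (h : c ⟶ d) :
    η ▷ (g ≫ h) = eqToHom (Bicategory.Strict.assoc f g h).symm ≫ η ▷ g ▷ h ≫
      eqToHom (Bicategory.Strict.assoc f' g h) := by
  rw [whiskerRight_comp, assoc_hom_eq, assoc_inv_eq]

theorem conj_mid {a b c d : B} (f : a ⟶ b) {g g' : b ⟶ c} (η : g ⟶ g') (h : c ⟶ d) :
    (f ◁ η) ▷ h = eqToHom (Bicategory.Strict.assoc f g h) ≫ f ◁ η ▷ h ≫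
      eqToHom (Bicategory.Strict.assoc f g' h).symm := by
  rw [whisker_assoc, assoc_hom_eq, assoc_inv_eq]

theorem conj_left' {a b c d : B} (f : a ⟶ b) (g : b ⟶ c) {h h' : c ⟶ d} (η : h ⟶ h') :
    f ◁ g ◁ η = eqToHom (Bicategory.Strict.assoc f g h).symm ≫ (f ≫ g) ◁ η ≫
      eqToHom (Bicategory.Strict.assoc f g h') := by
  rw [conj_comp_left]; simp

theorem conj_mid' {a b c d : B} (f : a ⟶ b) {g g' : b ⟶ c} (η : g ⟶ g') (h : c ⟶ d) :
    f ◁ η ▷ h = eqToHom (Bicategory.Strict.assoc f g h).symm ≫ (f ◁ η) ▷ h ≫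
      eqToHom (Bicategory.Strict.assoc f g' h) := by
  rw [conj_mid]; simp

theorem slide_mid {a b c d : B} (f : a ⟶ b) {g g' : b ⟶ c} (η : g ⟶ g') (h : c ⟶ d) :
    (f ◁ η) ▷ h ≫ eqToHom (Bicategory.Strict.assoc f g' h) =
      eqToHom (Bicategory.Strict.assoc f g h) ≫ f ◁ η ▷ h := by
  rw [conj_mid]; simp

theorem slide_mid' {a b c d : B} (f : a ⟶ b) {g g' : b ⟶ c} (η : g ⟶ g') (h : c ⟶ d) :
    f ◁ η ▷ h ≫ eqToHom (Bicategory.Strict.assoc f g' h).symm =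
      eqToHom (Bicategory.Strict.assoc f g h).symm ≫ (f ◁ η) ▷ h := by
  rw [conj_mid]; simp

theorem slide_left {a b c d : B} (f : a ⟶ b) (g : b ⟶ c) {h h' : c ⟶ d} (η : h ⟶ h') :
    (f ≫ g) ◁ η ≫ eqToHom (Bicategory.Strict.assoc f g h') =
      eqToHom (Bicategory.Strict.assoc f g h) ≫ f ◁ g ◁ η := by
  rw [conj_comp_left]; simp

theorem slide_left' {a b c d : B} (f : a ⟶ b) (g : b ⟶ c) {h h' : c ⟶ d} (η : h ⟶ h') :
    f ◁ g ◁ η ≫ eqToHom (Bicategory.Strict.assoc f g h').symm =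
      eqToHom (Bicategory.Strict.assoc f g h).symm ≫ (f ≫ g) ◁ η := by
  rw [conj_comp_left]; simp

theorem slide_right {a b c d : B} {f f' : a ⟶ b} (η : f ⟶ f') (g : b ⟶ c) (h : c ⟶ d) :
    η ▷ g ▷ h ≫ eqToHom (Bicategory.Strict.assoc f' g h) =
      eqToHom (Bicategory.Strict.assoc f g h) ≫ η ▷ (g ≫ h) := by
  rw [conj_comp_right]; simp

theorem slide_right' {a b c d : B} {f f' : a ⟶ b} (η : f ⟶ f') (g : b ⟶ c) (h : c ⟶ d) :
    η ▷ (g ≫ h) ≫ eqToHom (Bicategory.Strict.assoc f' g h).symm =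
      eqToHom (Bicategory.Strict.assoc f g h).symm ≫ η ▷ g ▷ h := by
  rw [conj_comp_right]; simp

end Strict

theorem four_rotate {D : Type u} [Category.{v} D] {a b c d d' t : D} {A : a ⟶ b} {e₁ : b = c}
    {B : c ⟶ d} {e₂ : d = d'} {R : a ⟶ d'} (h : A ≫ eqToHom e₁ ≫ B ≫ eqToHom e₂ = R)
    {r : d ⟶ t} : A ≫ eqToHom e₁ ≫ B ≫ r = R ≫ eqToHom e₂.symm ≫ r := by
  subst h
  simp

theorem conj_refl {D : Type u} [Category.{v} D] {a b : D} (t : a ⟶ b) :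
    t = eqToHom rfl ≫ t ≫ eqToHom rfl := by
  simp

/-- A `k`-cell from `f` to `g`, for a weakness `k`:
* a 2-cell `f ⟶ g` when `k = lax` (then `bwd` carries no data);
* a 2-cell `g ⟶ f` when `k = colax` (then `fwd` carries no data);
* an invertible 2-cell, recorded together with its inverse, when `k = pseudo`;
* an identity 2-cell when `k = strict` (so `f = g`).

A cell filling a square with top `t`, right side `r`, left side `l` and bottom `b` is a cell from
`t ≫ r` to `l ≫ b`. -/
@[ext]
structure Cell {B : Type u} [Bicategory.{w, v} B] (k : Weakness) {x y : B} (f g : x ⟶ y) where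
  /-- The 2-cell in the lax direction. -/
  fwd : k ≠ .colax → (f ⟶ g)
  /-- The 2-cell in the colax direction. -/
  bwd : k ≠ .lax → (g ⟶ f)
  fwd_bwd : ∀ h h', fwd h ≫ bwd h' = 𝟙 f
  bwd_fwd : ∀ h h', bwd h' ≫ fwd h = 𝟙 g
  eq_of_strict : k = .strict → ∃ e : f = g, ∀ h, fwd h = eqToHom e

namespace Cell

variable {B : Type u} [Bicategory.{w, v} B] {k k' : Weakness} {x y z : B}

/-- The identity cell given by an equality of 1-cells. -/
@[simps]
def ofEq {f g : x ⟶ y} (e : f = g) : Cell k f g where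
  fwd _ := eqToHom e
  bwd _ := eqToHom e.symm
  fwd_bwd _ _ := by simp
  bwd_fwd _ _ := by simp
  eq_of_strict _ := ⟨e, fun _ => rfl⟩

/-- Vertical composition of cells. -/
@[simps]
def trans {f g h : x ⟶ y} (χ : Cell k f g) (ξ : Cell k g h) : Cell k f h where
  fwd i := χ.fwd i ≫ ξ.fwd i
  bwd i := ξ.bwd i ≫ χ.bwd i
  fwd_bwd i j := by
    rw [Category.assoc, ← Category.assoc (ξ.fwd i), ξ.fwd_bwd, Category.id_comp, χ.fwd_bwd]
  bwd_fwd i j := by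
    rw [Category.assoc, ← Category.assoc (χ.bwd j), χ.bwd_fwd, Category.id_comp, ξ.bwd_fwd]
  eq_of_strict hk := by
    obtain ⟨e, he⟩ := χ.eq_of_strict hk
    obtain ⟨e', he'⟩ := ξ.eq_of_strict hk
    exact ⟨e.trans e', fun i => by rw [he, he', eqToHom_trans]⟩

/-- Whiskering a cell by a 1-cell on the left. -/
@[simps]
def wl (f : x ⟶ y) {g h : y ⟶ z} (χ : Cell k g h) : Cell k (f ≫ g) (f ≫ h) where
  fwd i := f ◁ χ.fwd i
  bwd i := f ◁ χ.bwd i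
  fwd_bwd i j := by rw [← whiskerLeft_comp, χ.fwd_bwd, whiskerLeft_id]
  bwd_fwd i j := by rw [← whiskerLeft_comp, χ.bwd_fwd, whiskerLeft_id]
  eq_of_strict hk := by
    obtain ⟨e, he⟩ := χ.eq_of_strict hk
    exact ⟨congrArg (f ≫ ·) e, fun i => by rw [he, whiskerLeft_eqToHom]⟩

/-- Whiskering a cell by a 1-cell on the right. -/
@[simps]
def wr {f g : x ⟶ y} (χ : Cell k f g) (h : y ⟶ z) : Cell k (f ≫ h) (g ≫ h) where
  fwd i := χ.fwd i ▷ h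
  bwd i := χ.bwd i ▷ h
  fwd_bwd i j := by rw [← comp_whiskerRight, χ.fwd_bwd, id_whiskerRight]
  bwd_fwd i j := by rw [← comp_whiskerRight, χ.bwd_fwd, id_whiskerRight]
  eq_of_strict hk := by
    obtain ⟨e, he⟩ := χ.eq_of_strict hk
    exact ⟨congrArg (· ≫ h) e, fun i => by rw [he, eqToHom_whiskerRight]⟩

/-- A `k'`-cell viewed as a `k`-cell, for `k' ≤ k`. -/
@[simps]
def weaken (hk : k' ≤ k) {f g : x ⟶ y} (χ : Cell k' f g) : Cell k f g where
  fwd i := χ.fwd (Weakness.ne_colax hk i)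
  bwd i := χ.bwd (Weakness.ne_lax hk i)
  fwd_bwd _ _ := χ.fwd_bwd _ _
  bwd_fwd _ _ := χ.bwd_fwd _ _
  eq_of_strict i := by
    obtain ⟨e, he⟩ := χ.eq_of_strict (Weakness.eq_strict hk i)
    exact ⟨e, fun _ => he _⟩

/-- The `k`-cell `χ` is a `k'`-cell (for `k' ≤ k`). -/
def IsCell (hk : k' ≤ k) {f g : x ⟶ y} (χ : Cell k f g) : Prop :=
  ∃ χ' : Cell k' f g, χ'.weaken hk = χ

section IsCell

variable (hk : k' ≤ k)

theorem isCell_ofEq {f g : x ⟶ y} (e : f = g) : (ofEq e : Cell k f g).IsCell hk :=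
  ⟨ofEq e, rfl⟩

theorem IsCell.trans {f g h : x ⟶ y} {χ : Cell k f g} {ξ : Cell k g h}
    (h₁ : χ.IsCell hk) (h₂ : ξ.IsCell hk) : (χ.trans ξ).IsCell hk := by
  obtain ⟨χ, rfl⟩ := h₁
  obtain ⟨ξ, rfl⟩ := h₂
  exact ⟨χ.trans ξ, rfl⟩

theorem IsCell.wl (f : x ⟶ y) {g h : y ⟶ z} {χ : Cell k g h} (h₁ : χ.IsCell hk) :
    (χ.wl f).IsCell hk := by
  obtain ⟨χ, rfl⟩ := h₁
  exact ⟨χ.wl f, rfl⟩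

theorem IsCell.wr {f g : x ⟶ y} {χ : Cell k f g} (h₁ : χ.IsCell hk) (h : y ⟶ z) :
    (χ.wr h).IsCell hk := by
  obtain ⟨χ, rfl⟩ := h₁
  exact ⟨χ.wr h, rfl⟩

end IsCell

/-- The square of 2-cells with sides `α`, `β`, `χ`, `ξ` commutes. (When both directions of the
cells `χ` and `ξ` are present they are mutually inverse, and the two equations are equivalent.) -/
def Comm {f f' g g' : x ⟶ y} (α : f ⟶ f') (β : g ⟶ g') (χ : Cell k f g) (ξ : Cell k f' g') :
    Prop :=
  (∀ i, α ≫ ξ.fwd i = χ.fwd i ≫ β) ∧ (∀ i, χ.bwd i ≫ α = β ≫ ξ.bwd i)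

namespace Comm

theorem id {f g : x ⟶ y} (χ : Cell k f g) : Comm (𝟙 f) (𝟙 g) χ χ :=
  ⟨fun _ => by simp, fun _ => by simp⟩

theorem comp {f f' f'' g g' g'' : x ⟶ y} {α : f ⟶ f'} {β : g ⟶ g'} {α' : f' ⟶ f''}
    {β' : g' ⟶ g''} {χ : Cell k f g} {χ' : Cell k f' g'} {χ'' : Cell k f'' g''}
    (h : Comm α β χ χ') (h' : Comm α' β' χ' χ'') : Comm (α ≫ α') (β ≫ β') χ χ'' :=
  ⟨fun i => by rw [Category.assoc, h'.1, ← Category.assoc, h.1, Category.assoc],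
   fun i => by rw [← Category.assoc, h.2, Category.assoc, h'.2, Category.assoc]⟩

theorem trans {f f' g g' h h' : x ⟶ y} {α : f ⟶ f'} {β : g ⟶ g'} {γ : h ⟶ h'}
    {χ : Cell k f g} {χ' : Cell k f' g'} {ξ : Cell k g h} {ξ' : Cell k g' h'}
    (h₁ : Comm α β χ χ') (h₂ : Comm β γ ξ ξ') : Comm α γ (χ.trans ξ) (χ'.trans ξ') :=
  ⟨fun i => by
      rw [trans_fwd, trans_fwd, ← Category.assoc, h₁.1, Category.assoc, h₂.1, Category.assoc],
   fun i => by
      rw [trans_bwd, trans_bwd, Category.assoc, h₁.2, ← Category.assoc, h₂.2, Category.assoc]⟩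

theorem wl (p : x ⟶ y) {f f' g g' : y ⟶ z} {α : f ⟶ f'} {β : g ⟶ g'} {χ : Cell k f g}
    {χ' : Cell k f' g'} (h : Comm α β χ χ') : Comm (p ◁ α) (p ◁ β) (χ.wl p) (χ'.wl p) :=
  ⟨fun i => by rw [wl_fwd, wl_fwd, ← whiskerLeft_comp, h.1, whiskerLeft_comp],
   fun i => by rw [wl_bwd, wl_bwd, ← whiskerLeft_comp, h.2, whiskerLeft_comp]⟩

theorem wr {f f' g g' : x ⟶ y} {α : f ⟶ f'} {β : g ⟶ g'} {χ : Cell k f g}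
    {χ' : Cell k f' g'} (h : Comm α β χ χ') (p : y ⟶ z) : Comm (α ▷ p) (β ▷ p) (χ.wr p) (χ'.wr p) :=
  ⟨fun i => by rw [wr_fwd, wr_fwd, ← comp_whiskerRight, h.1, comp_whiskerRight],
   fun i => by rw [wr_bwd, wr_bwd, ← comp_whiskerRight, h.2, comp_whiskerRight]⟩

theorem wr_exchange {f g : x ⟶ y} (χ : Cell k f g) {p q : y ⟶ z} (μ : p ⟶ q) :
    Comm (f ◁ μ) (g ◁ μ) (χ.wr p) (χ.wr q) :=
  ⟨fun i => by rw [wr_fwd, wr_fwd, whisker_exchange],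
   fun i => by rw [wr_bwd, wr_bwd, whisker_exchange]⟩

theorem wl_exchange {p q : x ⟶ y} (μ : p ⟶ q) {f g : y ⟶ z} (χ : Cell k f g) :
    Comm (μ ▷ f) (μ ▷ g) (χ.wl p) (χ.wl q) :=
  ⟨fun i => by rw [wl_fwd, wl_fwd, whisker_exchange],
   fun i => by rw [wl_bwd, wl_bwd, whisker_exchange]⟩

theorem ofEq {f f' g g' : x ⟶ y} {α : f ⟶ f'} {β : g ⟶ g'} {e : f = g} {e' : f' = g'}
    (h : α ≫ eqToHom e' = eqToHom e ≫ β) :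
    Comm α β (Cell.ofEq e : Cell k f g) (Cell.ofEq e') := by
  subst e e'
  simp only [eqToHom_refl, Category.comp_id, Category.id_comp] at h
  subst h
  exact ⟨fun _ => by simp, fun _ => by simp⟩

end Comm

end Cell

/-! ## Enhanced 2-categories -/

/-- An enhanced 2-category (`ℱ`-category): a 2-category of loose morphisms together with a wide
and locally full sub-2-category of tight morphisms. -/
structure FCat : Type (max (u + 1) (v + 1) (w + 1)) where
  /-- The objects. -/
  carrier : Type u
  [bicategory : Bicategory.{w, v} carrier]
  [strict : Bicategory.Strict carrier]
  /-- A loose morphism is tight. -/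
  Tight : ∀ {x y : carrier}, (x ⟶ y) → Prop
  tight_id : ∀ x : carrier, Tight (𝟙 x)
  tight_comp : ∀ {x y z : carrier} {f : x ⟶ y} {g : y ⟶ z}, Tight f → Tight g → Tight (f ≫ g)

attribute [instance] FCat.bicategory FCat.strict

instance : CoeSort FCat.{w, v, u} (Type u) := ⟨FCat.carrier⟩

/-- An `ℱ`-functor: a (strict) 2-functor between the 2-categories of loose morphisms that
preserves tightness. -/
structure FFunctor (A : FCat.{w₁, v₁, u₁}) (B : FCat.{w₂, v₂, u₂}) extends
    StrictPseudofunctorPreCore A B where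
  map_tight : ∀ {x y : A} {f : x ⟶ y}, A.Tight f → B.Tight (map f)

namespace FFunctor

variable {A : FCat.{w₁, v₁, u₁}} {B : FCat.{w₂, v₂, u₂}} {C : FCat.{w₃, v₃, u₃}}

theorem map₂_eqToHom (F : FFunctor A B) {x y : A} {f g : x ⟶ y} (e : f = g) :
    F.map₂ (eqToHom e) = eqToHom (congrArg F.map e) := by
  subst e
  simp [F.map₂_id]

variable (A) in
/-- The identity `ℱ`-functor. -/
def id : FFunctor A A where
  obj x := x
  map f := f
  map₂ η := η
  map₂_id _ := rfl
  map₂_comp _ _ := rfl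
  map_id _ := rfl
  map_comp _ _ := rfl
  map₂_whisker_left _ _ _ _ := by simp
  map₂_whisker_right _ _ := by simp
  map_tight h := h

/-- Composition of `ℱ`-functors. -/
def comp (F : FFunctor A B) (G : FFunctor B C) : FFunctor A C where
  obj x := G.obj (F.obj x)
  map f := G.map (F.map f)
  map₂ η := G.map₂ (F.map₂ η)
  map₂_id _ := by rw [F.map₂_id, G.map₂_id]
  map₂_comp _ _ := by rw [F.map₂_comp, G.map₂_comp]
  map_id _ := by rw [F.map_id, G.map_id]
  map_comp _ _ := by rw [F.map_comp, G.map_comp]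
  map₂_whisker_left _ _ _ _ := by
    rw [F.map₂_whisker_left, G.map₂_comp, G.map₂_comp, G.map₂_whisker_left, map₂_eqToHom,
      map₂_eqToHom]
    simp
  map₂_whisker_right _ _ := by
    rw [F.map₂_whisker_right, G.map₂_comp, G.map₂_comp, G.map₂_whisker_right, map₂_eqToHom,
      map₂_eqToHom]
    simp
  map_tight h := G.map_tight (F.map_tight h)

end FFunctor

/-- An `ℱ`-natural transformation: a 2-natural transformation with tight components. -/
@[ext]
structure FNatTrans {A : FCat.{w₁, v₁, u₁}} {B : FCat.{w₂, v₂, u₂}} (F G : FFunctor A B) where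
  /-- The components. -/
  app : ∀ x : A, F.obj x ⟶ G.obj x
  tight : ∀ x, B.Tight (app x)
  naturality : ∀ {x y : A} (f : x ⟶ y), app x ≫ G.map f = F.map f ≫ app y
  naturality₂ : ∀ {x y : A} {f g : x ⟶ y} (η : f ⟶ g),
    app x ◁ G.map₂ η ≫ eqToHom (naturality g) = eqToHom (naturality f) ≫ F.map₂ η ▷ app y

namespace FNatTrans

variable {A : FCat.{w₁, v₁, u₁}} {B : FCat.{w₂, v₂, u₂}} {C : FCat.{w₃, v₃, u₃}}

/-- Vertical composition of `ℱ`-natural transformations. -/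
def comp {F G H : FFunctor A B} (α : FNatTrans F G) (β : FNatTrans G H) : FNatTrans F H where
  app x := α.app x ≫ β.app x
  tight x := B.tight_comp (α.tight x) (β.tight x)
  naturality f := by
    rw [Bicategory.Strict.assoc, β.naturality, ← Bicategory.Strict.assoc, α.naturality,
      Bicategory.Strict.assoc]
  naturality₂ {x y f g} η := by
    have h₁ := congrArg (fun t => α.app x ◁ t) (β.naturality₂ η)
    have h₂ := congrArg (fun t => t ▷ β.app y) (α.naturality₂ η)
    simp only [whiskerLeft_comp, comp_whiskerRight, whiskerLeft_eqToHom,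
      eqToHom_whiskerRight] at h₁ h₂
    rw [comp_whiskerLeft, whiskerRight_comp, assoc_hom_eq, assoc_inv_eq, assoc_hom_eq,
      assoc_inv_eq]
    rw [← cancel_mono (eqToHom (congrArg (α.app x ≫ ·) (β.naturality g)).symm)] at h₁
    rw [← cancel_epi (eqToHom (congrArg (· ≫ β.app y) (α.naturality f)).symm)] at h₂
    simp only [Category.assoc, eqToHom_trans, eqToHom_refl, Category.comp_id,
      eqToHom_trans_assoc, Category.id_comp] at h₁ h₂
    rw [h₁, ← h₂]
    simp [assoc_hom_eq, assoc_inv_eq]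

/-- Precomposition of an `ℱ`-natural transformation with an `ℱ`-functor. -/
def precomp (D : FFunctor A B) {F G : FFunctor B C} (α : FNatTrans F G) :
    FNatTrans (D.comp F) (D.comp G) where
  app x := α.app (D.obj x)
  tight x := α.tight (D.obj x)
  naturality f := α.naturality (D.map f)
  naturality₂ η := α.naturality₂ (D.map₂ η)

end FNatTrans

/-! ## Full sub-`ℱ`-categories -/

/-- The bicategory structure pulled back along a function on objects. -/
abbrev pullBicategory {X : Type u₁} {B : Type u} [Bicategory.{w, v} B] (F : X → B) :
    Bicategory.{w, v} X where
  Hom a b := F a ⟶ F b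
  id a := 𝟙 (F a)
  comp f g := f ≫ g
  homCategory a b := (inferInstance : Category (F a ⟶ F b))
  whiskerLeft f _ _ η := f ◁ η
  whiskerRight η h := η ▷ h
  associator f g h := α_ f g h
  leftUnitor f := λ_ f
  rightUnitor f := ρ_ f
  whiskerLeft_id _ _ := Bicategory.whiskerLeft_id _ _
  whiskerLeft_comp _ _ _ _ _ _ := Bicategory.whiskerLeft_comp _ _ _
  id_whiskerLeft _ := Bicategory.id_whiskerLeft _
  comp_whiskerLeft _ _ _ _ _ := Bicategory.comp_whiskerLeft _ _ _
  id_whiskerRight _ _ := Bicategory.id_whiskerRight _ _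
  comp_whiskerRight _ _ _ := Bicategory.comp_whiskerRight _ _ _
  whiskerRight_id _ := Bicategory.whiskerRight_id _
  whiskerRight_comp _ _ _ := Bicategory.whiskerRight_comp _ _ _
  whisker_assoc _ _ _ _ _ := Bicategory.whisker_assoc _ _ _
  whisker_exchange _ _ := Bicategory.whisker_exchange _ _
  pentagon _ _ _ _ := Bicategory.pentagon _ _ _ _
  triangle _ _ := Bicategory.triangle _ _

theorem pullStrict {X : Type u₁} {B : Type u} [Bicategory.{w, v} B] [Bicategory.Strict B]
    (F : X → B) : @Bicategory.Strict X (pullBicategory F) :=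
  letI := pullBicategory F
  { id_comp := fun f => Bicategory.Strict.id_comp (B := B) f
    comp_id := fun f => Bicategory.Strict.comp_id (B := B) f
    assoc := fun f g h => Bicategory.Strict.assoc (B := B) f g h
    leftUnitor_eqToIso := fun f => Bicategory.Strict.leftUnitor_eqToIso (B := B) f
    rightUnitor_eqToIso := fun f => Bicategory.Strict.rightUnitor_eqToIso (B := B) f
    associator_eqToIso := fun f g h => Bicategory.Strict.associator_eqToIso (B := B) f g h }

/-- The full sub-`ℱ`-category of `A` spanned by the objects satisfying `P`. -/
abbrev FCat.full (A : FCat.{w, v, u}) (P : A → Prop) : FCat.{w, v, u} where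
  carrier := {x : A // P x}
  bicategory := pullBicategory Subtype.val
  strict := pullStrict Subtype.val
  Tight {x y} f := A.Tight (x := x.1) (y := y.1) f
  tight_id x := A.tight_id x.1
  tight_comp h h' := A.tight_comp h h'

/-! ## The `ℱ`-category `𝔽` and the representables -/

/-- An object of `ℱ`: a full embedding of small categories, i.e. a fully faithful functor that is
injective on objects. -/
structure FObj : Type (u + 1) where
  /-- The tight part. -/
  tight : Cat.{u, u}
  /-- The loose part. -/
  loose : Cat.{u, u}
  /-- The embedding. -/
  incl : tight ⥤ loose
  full : incl.Full
  faithful : incl.Faithful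
  injective : Function.Injective incl.obj

/-- The `ℱ`-category `𝔽`: a loose morphism is a functor between the loose parts, and is
tight when it restricts to a functor between the tight parts; a 2-cell is a natural transformation
between functors of the loose parts. -/
def bbF : FCat.{u, u, u + 1} where
  carrier := FObj.{u}
  bicategory := pullBicategory FObj.loose
  strict := pullStrict FObj.loose
  Tight {A B} f := ∃ g : A.tight ⥤ B.tight,
    A.incl ⋙ Cat.Hom.toFunctor (C := A.loose) (D := B.loose) f = g ⋙ B.incl
  tight_id A := ⟨𝟭 _, rfl⟩
  tight_comp := by
    rintro A B C f f' ⟨g, hg⟩ ⟨g', hg'⟩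
    refine ⟨g ⋙ g', ?_⟩
    change (A.incl ⋙ Cat.Hom.toFunctor (C := A.loose) (D := B.loose) f) ⋙
      Cat.Hom.toFunctor (C := B.loose) (D := C.loose) f' = _
    rw [hg, Functor.assoc, hg', Functor.assoc]

/-- Tightness as a property of objects of the category of loose morphisms from `x` to `y`. -/
def FCat.tightProp (A : FCat.{w, v, u}) (x y : A) : ObjectProperty (x ⟶ y) :=
  fun f => A.Tight f

/-- The hom-object `A(x, y)` of an `ℱ`-category: the inclusion of the category of tight morphisms
into the category of loose morphisms. -/
def FCat.homObj (A : FCat.{u, u, w}) (x y : A) : FObj.{u} where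
  tight := Cat.of (A.tightProp x y).FullSubcategory
  loose := Cat.of (x ⟶ y)
  incl := (A.tightProp x y).ι
  full := inferInstanceAs (A.tightProp x y).ι.Full
  faithful := inferInstanceAs (A.tightProp x y).ι.Faithful
  injective := by
    rintro ⟨f, hf⟩ ⟨g, hg⟩ h
    cases h
    rfl

section

variable {B : Type w} [Bicategory.{u, u} B] [Bicategory.Strict B]

theorem postcomp_id (x y : B) : postcomp x (𝟙 y) = 𝟭 (x ⟶ y) :=
  CategoryTheory.Functor.ext (fun f => Bicategory.Strict.comp_id f) fun f g η => by
    change η ▷ 𝟙 y = eqToHom _ ≫ η ≫ eqToHom _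
    rw [whiskerRight_id, rightUnitor_hom_eq, rightUnitor_inv_eq]

theorem postcomp_comp (x : B) {y z t : B} (g : y ⟶ z) (h : z ⟶ t) :
    postcomp x (g ≫ h) = postcomp x g ⋙ postcomp x h :=
  CategoryTheory.Functor.ext (fun f => (Bicategory.Strict.assoc f g h).symm) fun f f' η => by
    change η ▷ (g ≫ h) = eqToHom _ ≫ (η ▷ g) ▷ h ≫ eqToHom _
    rw [whiskerRight_comp, assoc_hom_eq, assoc_inv_eq]

end

theorem cat_comp_eqToHom_app {X Y : Cat.{u, u}} {F G G' : X ⟶ Y} (t : F ⟶ G) (e : G = G') (x : X) :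
    (t ≫ eqToHom e).toNatTrans.app x = t.toNatTrans.app x ≫ eqToHom (by rw [e]) := by
  subst e
  simp

theorem cat_eqToHom_comp_app {X Y : Cat.{u, u}} {F F' G : X ⟶ Y} (e : F = F') (t : F' ⟶ G) (x : X) :
    (eqToHom e ≫ t).toNatTrans.app x = eqToHom (by rw [e]) ≫ t.toNatTrans.app x := by
  subst e
  simp

theorem cat_conj_app {X Y : Cat.{u, u}} {F F' G G' : X ⟶ Y} (e : F = F') (e' : G' = G)
    (t : F' ⟶ G') (x : X) : (eqToHom e ≫ t ≫ eqToHom e').toNatTrans.app x =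
      eqToHom (by rw [e]) ≫ t.toNatTrans.app x ≫ eqToHom (by rw [e']) := by
  subst e e'
  simp

/-- The representable `ℱ`-functor `A(x, -) : A ⟶ 𝔽`. -/
def FCat.repr (A : FCat.{u, u, w}) (x : A) : FFunctor A bbF.{u} where
  obj y := A.homObj x y
  map {y z} g := (postcomp x g).toCatHom
  map₂ η := NatTrans.toCatHom₂
    { app := fun f => f ◁ η
      naturality := fun _ _ ξ => (whisker_exchange ξ η).symm }
  map₂_id f := Cat.Hom₂.ext (NatTrans.ext (funext fun h => whiskerLeft_id h f))
  map₂_comp η θ := Cat.Hom₂.ext (NatTrans.ext (funext fun h => whiskerLeft_comp h η θ))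
  map_id y := Cat.ext (postcomp_id x y)
  map_comp {y z t} g h := Cat.ext (postcomp_comp x g h)
  map₂_whisker_left f g g' η := Cat.Hom₂.ext (NatTrans.ext (funext fun h => by
    refine Eq.trans ?_ (cat_conj_app _ _ _ h).symm
    exact conj_left' h f η))
  map₂_whisker_right η g := Cat.Hom₂.ext (NatTrans.ext (funext fun h => by
    refine Eq.trans ?_ (cat_conj_app _ _ _ h).symm
    exact conj_mid' h η g))
  map_tight {y z g} hg := ⟨(A.tightProp x z).lift ((A.tightProp x y).ι ⋙ postcomp x g)
    fun f => A.tight_comp f.property hg, rfl⟩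

/-- The action of an `ℱ`-functor on the category of loose morphisms from `x` to `y`. -/
def FFunctor.homFunctor {A : FCat.{w₁, v₁, u₁}} {B : FCat.{w₂, v₂, u₂}} (F : FFunctor A B)
    (x y : A) : (x ⟶ y) ⥤ (F.obj x ⟶ F.obj y) where
  obj f := F.map f
  map η := F.map₂ η
  map_id := F.map₂_id
  map_comp := F.map₂_comp

theorem FFunctor.conj_map_right {A : FCat.{w₁, v₁, u₁}} {B : FCat.{w₂, v₂, u₂}} (F : FFunctor A B)
    {x y z : A} {f f' : x ⟶ y} (η : f ⟶ f') (g : y ⟶ z) :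
    F.map₂ η ▷ F.map g = eqToHom (F.map_comp f g).symm ≫ F.map₂ (η ▷ g) ≫
      eqToHom (F.map_comp f' g) := by
  rw [F.map₂_whisker_right]
  simp

theorem FFunctor.homFunctor_postcomp {A : FCat.{u, u, v}} {B : FCat.{u, u, w}} (F : FFunctor A B)
    (x : A) {y z : A} (g : y ⟶ z) :
    F.homFunctor x y ⋙ postcomp (F.obj x) (F.map g) = postcomp x g ⋙ F.homFunctor x z :=
  CategoryTheory.Functor.ext (fun f => (F.map_comp f g).symm) fun _ _ η =>
    F.conj_map_right η g

theorem FFunctor.conj_map {A : FCat.{u, u, v}} {B : FCat.{u, u, w}} (F : FFunctor A B)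
    {x y z : A} (h : x ⟶ y) {g g' : y ⟶ z} (η : g ⟶ g') :
    F.map h ◁ F.map₂ η ≫ eqToHom (F.map_comp h g').symm =
      eqToHom (F.map_comp h g).symm ≫ F.map₂ (h ◁ η) := by
  rw [F.map₂_whisker_left]
  simp

/-- The `ℱ`-natural transformation `A(x, -) ⟶ B(F x, F -)` given by the action of an `ℱ`-functor
`F : A ⟶ B` on hom-objects. -/
def FFunctor.reprMap {A : FCat.{u, u, v}} {B : FCat.{u, u, w}} (F : FFunctor A B) (x : A) :
    FNatTrans (A.repr x) (F.comp (B.repr (F.obj x))) where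
  app y := (F.homFunctor x y).toCatHom
  tight y := ⟨(B.tightProp _ _).lift ((A.tightProp x y).ι ⋙ F.homFunctor x y)
    fun f => F.map_tight f.property, rfl⟩
  naturality {y z} g := Cat.ext (F.homFunctor_postcomp x g)
  naturality₂ {y z g g'} η := Cat.Hom₂.ext (NatTrans.ext (funext fun h => by
    refine (cat_comp_eqToHom_app _ _ h).trans (Eq.trans ?_ (cat_eqToHom_comp_app _ _ h).symm)
    exact F.conj_map h η))

/-! ## Sketches -/

/-- A weighted cone in a small `ℱ`-category `A`, for a weight with small domain. -/
structure Cone (A : FCat.{u, u, u}) : Type (u + 1) where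
  /-- The domain of the weight. -/
  J : FCat.{u, u, u}
  /-- The weight. -/
  W : FFunctor J bbF.{u}
  /-- The diagram. -/
  D : FFunctor J A
  /-- The apex. -/
  X : A
  /-- The cone `W ⟶ A(X, D -)`. -/
  γ : FNatTrans W (D.comp (A.repr X))

/-- The image of a weighted cone under an `ℱ`-functor. -/
def Cone.map {A B : FCat.{u, u, u}} (c : Cone A) (F : FFunctor A B) : Cone B where
  J := c.J
  W := c.W
  D := c.D.comp F
  X := F.obj c.X
  γ := c.γ.comp ((F.reprMap c.X).precomp c.D)

/-- An enhanced limit 2-sketch (`ℱ`-sketch): a small `ℱ`-category equipped with a class of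
weighted cones. -/
structure FSketch : Type (u + 1) where
  /-- The underlying `ℱ`-category. -/
  cat : FCat.{u, u, u}
  /-- The specified weighted cones. -/
  cones : Set (Cone cat)

/-- An `ℱ`-functor between `ℱ`-sketches is a model (that is, a morphism of `ℱ`-sketches) when it
sends specified cones to specified cones. -/
def IsModel (S C : FSketch.{u}) (F : FFunctor S.cat C.cat) : Prop :=
  ∀ c ∈ S.cones, c.map F ∈ C.cones

theorem Cone.map_id {A : FCat.{u, u, u}} (c : Cone A) : c.map (FFunctor.id A) = c := rfl

theorem Cone.map_comp {A B C : FCat.{u, u, u}} (c : Cone A) (F : FFunctor A B) (G : FFunctor B C) :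
    c.map (F.comp G) = (c.map F).map G := rfl

/-- The category of `ℱ`-sketches and their morphisms. Its isomorphisms are the isomorphisms of
`ℱ`-sketches. -/
instance : Category FSketch.{u} where
  Hom S C := {F : FFunctor S.cat C.cat // IsModel S C F}
  id S := ⟨FFunctor.id S.cat, fun c hc => by rwa [Cone.map_id]⟩
  comp F G := ⟨F.1.comp G.1, fun c hc => by
    rw [Cone.map_comp]; exact G.2 _ (F.2 c hc)⟩

/-! ## The `ℱ`-category of `ℱ`-functors and loose transformations -/

section Fun

variable {k' k : Weakness} {S C : FCat.{u, u, u}}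

/-- A loose `(k', k)`-natural transformation between `ℱ`-functors `M` and `N`: loose components and
`k`-cells filling the naturality squares, which are `k'`-cells at tight morphisms, compatible with
2-cells, identities and composition (that is, a strict, pseudo, lax or colax natural transformation
according to `k`). -/
structure LooseTrans (hk : k' ≤ k) (M N : FFunctor S C) : Type u where
  /-- The components. -/
  app : ∀ x : S, M.obj x ⟶ N.obj x
  /-- The `k`-cell in the naturality square with top `app x`, right side `N.map f`, left side
  `M.map f` and bottom `app y`. -/
  cell : ∀ {x y : S} (f : x ⟶ y), Cell k (app x ≫ N.map f) (M.map f ≫ app y)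
  cell_tight : ∀ {x y : S} {f : x ⟶ y}, S.Tight f → (cell f).IsCell hk
  cell_naturality : ∀ {x y : S} {f g : x ⟶ y} (η : f ⟶ g),
    Cell.Comm (app x ◁ N.map₂ η) (M.map₂ η ▷ app y) (cell f) (cell g)
  cell_id : ∀ x : S, cell (𝟙 x) = Cell.ofEq
    (by rw [M.map_id, N.map_id, Bicategory.Strict.id_comp, Bicategory.Strict.comp_id])
  cell_comp : ∀ {x y z : S} (f : x ⟶ y) (g : y ⟶ z), cell (f ≫ g) =
    (Cell.ofEq (by rw [N.map_comp, Bicategory.Strict.assoc])).trans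
      (((cell f).wr (N.map g)).trans
        ((Cell.ofEq (Bicategory.Strict.assoc _ _ _)).trans
          (((cell g).wl (M.map f)).trans
            (Cell.ofEq (by rw [M.map_comp, Bicategory.Strict.assoc])))))

namespace LooseTrans

variable {hk : k' ≤ k} {M N P Q : FFunctor S C}

theorem ext_of_comm {φ ψ : LooseTrans hk M N} (h : ∀ x, φ.app x = ψ.app x)
    (h' : ∀ {x y : S} (f : x ⟶ y), Cell.Comm (eqToHom (h x) ▷ N.map f)
      (M.map f ◁ eqToHom (h y)) (φ.cell f) (ψ.cell f)) : φ = ψ := by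
  obtain ⟨a, c, _, _, _, _⟩ := φ
  obtain ⟨a', c', _, _, _, _⟩ := ψ
  obtain rfl : a = a' := funext h
  have : @c = @c' := by
    funext x y f
    obtain ⟨h₁, h₂⟩ := h' f
    ext i
    · simpa using (h₁ i).symm
    · simpa using h₂ i
  subst this
  rfl

/-- The identity transformation. -/
def id (hk : k' ≤ k) (M : FFunctor S C) : LooseTrans hk M M where
  app x := 𝟙 (M.obj x)
  cell f := Cell.ofEq (by rw [Bicategory.Strict.id_comp, Bicategory.Strict.comp_id])
  cell_tight _ := Cell.isCell_ofEq hk _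
  cell_naturality η := Cell.Comm.ofEq (by
    rw [id_whiskerLeft, whiskerRight_id, leftUnitor_hom_eq, leftUnitor_inv_eq, rightUnitor_hom_eq,
      rightUnitor_inv_eq]
    simp)
  cell_id _ := rfl
  cell_comp _ _ := by
    ext i <;> simp

/-- The pasting of two naturality squares. -/
abbrev compCell {B : Type u} [Bicategory.{w, v} B] [Bicategory.Strict B] {x y z x' y' z' : B}
    {f : x ⟶ y} {g : y ⟶ z} {f' : x' ⟶ y'} {g' : y' ⟶ z'} {a : x ⟶ x'} {b : y ⟶ y'}
    {c : z ⟶ z'} (χ : Cell k (f ≫ b) (a ≫ f')) (ξ : Cell k (g ≫ c) (b ≫ g')) :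
    Cell k ((f ≫ g) ≫ c) (a ≫ f' ≫ g') :=
  (Cell.ofEq (Bicategory.Strict.assoc _ _ _)).trans
    ((ξ.wl f).trans ((Cell.ofEq (Bicategory.Strict.assoc _ _ _).symm).trans
      ((χ.wr g').trans (Cell.ofEq (Bicategory.Strict.assoc _ _ _)))))

theorem isCell_compCell {B : Type u} [Bicategory.{w, v} B] [Bicategory.Strict B]
    {x y z x' y' z' : B} {f : x ⟶ y} {g : y ⟶ z} {f' : x' ⟶ y'} {g' : y' ⟶ z'} {a : x ⟶ x'}
    {b : y ⟶ y'} {c : z ⟶ z'} {χ : Cell k (f ≫ b) (a ≫ f')} {ξ : Cell k (g ≫ c) (b ≫ g')}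
    (h : χ.IsCell hk) (h' : ξ.IsCell hk) : (compCell χ ξ).IsCell hk :=
  (Cell.isCell_ofEq hk _).trans hk ((h'.wl hk _).trans hk ((Cell.isCell_ofEq hk _).trans hk
    ((h.wr hk _).trans hk (Cell.isCell_ofEq hk _))))

/-- Composition of transformations: the naturality cells are pasted. -/
def comp (φ : LooseTrans hk M N) (ψ : LooseTrans hk N P) : LooseTrans hk M P where
  app x := φ.app x ≫ ψ.app x
  cell f := compCell (φ.cell f) (ψ.cell f)
  cell_tight hf := isCell_compCell (φ.cell_tight hf) (ψ.cell_tight hf)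
  cell_naturality {x y f g} η := by
    refine Cell.Comm.trans (β := φ.app x ◁ (ψ.app x ◁ P.map₂ η)) (Cell.Comm.ofEq ?_)
      (((ψ.cell_naturality η).wl _).trans
      (Cell.Comm.trans (β := (φ.app x ◁ N.map₂ η) ▷ ψ.app y) (Cell.Comm.ofEq ?_)
      (((φ.cell_naturality η).wr _).trans (Cell.Comm.ofEq ?_))))
    · exact slide_left _ _ _
    · exact slide_mid' _ _ _
    · exact slide_right _ _ _
  cell_id x := by
    rw [φ.cell_id, ψ.cell_id]
    ext i <;> simp
  cell_comp {x y z} f g := by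
    rw [φ.cell_comp, ψ.cell_comp]
    ext i
    · have ex := whisker_exchange ((φ.cell f).fwd i) ((ψ.cell g).fwd i)
      simp only [comp_whiskerLeft, whiskerRight_comp, assoc_hom_eq, assoc_inv_eq,
        Category.assoc, eqToHom_trans_assoc] at ex
      rw [eqToHom_comp_iff] at ex
      simp only [eqToHom_trans_assoc] at ex
      simp only [Cell.trans_fwd, Cell.wl_fwd, Cell.wr_fwd, Cell.ofEq_fwd, whiskerLeft_comp,
        comp_whiskerRight, whisker_assoc, assoc_hom_eq, assoc_inv_eq, whiskerLeft_eqToHom, eqToHom_whiskerRight, Category.assoc, eqToHom_trans,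
        eqToHom_trans_assoc]
      rw [four_rotate ex]
      simp
    · have ex := whisker_exchange ((φ.cell f).bwd i) ((ψ.cell g).bwd i)
      simp only [comp_whiskerLeft, whiskerRight_comp, assoc_hom_eq, assoc_inv_eq,
        Category.assoc, eqToHom_trans_assoc] at ex
      rw [eqToHom_comp_iff] at ex
      simp only [eqToHom_trans_assoc] at ex
      simp only [Cell.trans_bwd, Cell.wl_bwd, Cell.wr_bwd, Cell.ofEq_bwd, whiskerLeft_comp,
        comp_whiskerRight, whisker_assoc, assoc_hom_eq, assoc_inv_eq, whiskerLeft_eqToHom, eqToHom_whiskerRight, Category.assoc, eqToHom_trans,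
        eqToHom_trans_assoc]
      rw [four_rotate ex]
      simp

end LooseTrans

/-- A modification between loose transformations. -/
@[ext]
structure Modification {hk : k' ≤ k} {M N : FFunctor S C} (φ ψ : LooseTrans hk M N) : Type u where
  /-- The components. -/
  app : ∀ x : S, φ.app x ⟶ ψ.app x
  comm : ∀ {x y : S} (f : x ⟶ y),
    Cell.Comm (app x ▷ N.map f) (M.map f ◁ app y) (φ.cell f) (ψ.cell f)

namespace Modification

variable {hk : k' ≤ k} {M N P Q : FFunctor S C}

/-- The identity modification. -/
@[simps]
def id (φ : LooseTrans hk M N) : Modification φ φ where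
  app x := 𝟙 (φ.app x)
  comm f := by
    rw [id_whiskerRight, Bicategory.whiskerLeft_id]
    exact Cell.Comm.id _

/-- Vertical composition of modifications. -/
@[simps]
def comp {φ ψ χ : LooseTrans hk M N} (μ : Modification φ ψ) (ν : Modification ψ χ) :
    Modification φ χ where
  app x := μ.app x ≫ ν.app x
  comm f := by
    rw [comp_whiskerRight, Bicategory.whiskerLeft_comp]
    exact (μ.comm f).comp (ν.comm f)

instance : Category (LooseTrans hk M N) where
  Hom φ ψ := Modification φ ψ
  id φ := Modification.id φ
  comp μ ν := Modification.comp μ ν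
  id_comp _ := Modification.ext (funext fun _ => Category.id_comp _)
  comp_id _ := Modification.ext (funext fun _ => Category.comp_id _)
  assoc _ _ _ := Modification.ext (funext fun _ => Category.assoc _ _ _)

@[ext]
theorem hom_ext {φ ψ : LooseTrans hk M N} {μ ν : φ ⟶ ψ}
    (h : ∀ x, Modification.app μ x = Modification.app ν x) : μ = ν :=
  Modification.ext (funext h)

@[simp]
theorem id_app' (φ : LooseTrans hk M N) (x : S) : Modification.app (𝟙 φ) x = 𝟙 (φ.app x) := rfl

@[simp]
theorem comp_app' {φ ψ χ : LooseTrans hk M N} (μ : φ ⟶ ψ) (ν : ψ ⟶ χ) (x : S) :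
    Modification.app (μ ≫ ν) x = Modification.app μ x ≫ Modification.app ν x := rfl

@[simp]
theorem eqToHom_app {φ ψ : LooseTrans hk M N} (e : φ = ψ) (x : S) :
    Modification.app (eqToHom e) x = eqToHom (by rw [e]) := by
  subst e
  rfl

theorem conj_app {φ φ' ψ ψ' : LooseTrans hk M N} (e : φ = φ') (t : φ' ⟶ ψ') (e' : ψ' = ψ) (x : S) :
    Modification.app (eqToHom e ≫ t ≫ eqToHom e') x =
      eqToHom (by rw [e]) ≫ Modification.app t x ≫ eqToHom (by rw [e']) := by
  subst e e'
  simp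

/-- Whiskering of a modification on the left. -/
@[simps]
def wl (φ : LooseTrans hk M N) {ψ χ : LooseTrans hk N P} (μ : Modification ψ χ) :
    Modification (φ.comp ψ) (φ.comp χ) where
  app x := φ.app x ◁ μ.app x
  comm {x y} f := by
    refine Cell.Comm.trans (β := φ.app x ◁ (μ.app x ▷ P.map f)) (Cell.Comm.ofEq ?_)
      (((μ.comm f).wl _).trans
      (Cell.Comm.trans (β := (φ.app x ≫ N.map f) ◁ μ.app y) (Cell.Comm.ofEq ?_)
      ((Cell.Comm.wr_exchange _ _).trans (Cell.Comm.ofEq ?_))))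
    · exact slide_mid _ _ _
    · exact slide_left' _ _ _
    · exact slide_left _ _ _

/-- Whiskering of a modification on the right. -/
@[simps]
def wr {φ ψ : LooseTrans hk M N} (μ : Modification φ ψ) (χ : LooseTrans hk N P) :
    Modification (φ.comp χ) (ψ.comp χ) where
  app x := μ.app x ▷ χ.app x
  comm {x y} f := by
    refine Cell.Comm.trans (β := μ.app x ▷ (χ.app x ≫ P.map f)) (Cell.Comm.ofEq ?_)
      ((Cell.Comm.wl_exchange _ _).trans
      (Cell.Comm.trans (β := (μ.app x ▷ N.map f) ▷ χ.app y) (Cell.Comm.ofEq ?_)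
      (((μ.comm f).wr _).trans (Cell.Comm.ofEq ?_))))
    · exact slide_right _ _ _
    · exact slide_right' _ _ _
    · exact slide_mid _ _ _

theorem wl_eqToHom (φ : LooseTrans hk M N) {ψ χ : LooseTrans hk N P} (e : ψ = χ) :
    (Modification.wl φ (eqToHom e : ψ ⟶ χ) : φ.comp ψ ⟶ φ.comp χ) =
      eqToHom (congrArg φ.comp e) := by
  subst e
  exact Modification.hom_ext fun x => Bicategory.whiskerLeft_id _ _

theorem wr_eqToHom {φ ψ : LooseTrans hk M N} (e : φ = ψ) (χ : LooseTrans hk N P) :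
    (Modification.wr (eqToHom e : φ ⟶ ψ) χ : φ.comp χ ⟶ ψ.comp χ) =
      eqToHom (congrArg (fun t => t.comp χ) e) := by
  subst e
  exact Modification.hom_ext fun x => Bicategory.id_whiskerRight _ _

end Modification

namespace LooseTrans

variable {hk : k' ≤ k} {M N P Q : FFunctor S C}

theorem id_comp' (φ : LooseTrans hk M N) : (LooseTrans.id hk M).comp φ = φ :=
  ext_of_comm (fun x => Bicategory.Strict.id_comp _) fun f => by
    constructor <;> intro i <;> simp [LooseTrans.comp, LooseTrans.id, leftUnitor_hom_eq, leftUnitor_inv_eq]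

theorem comp_id' (φ : LooseTrans hk M N) : φ.comp (LooseTrans.id hk N) = φ :=
  ext_of_comm (fun x => Bicategory.Strict.comp_id _) fun f => by
    constructor <;> intro i <;> simp [LooseTrans.comp, LooseTrans.id, rightUnitor_hom_eq, rightUnitor_inv_eq]

theorem assoc' (φ : LooseTrans hk M N) (ψ : LooseTrans hk N P) (χ : LooseTrans hk P Q) :
    (φ.comp ψ).comp χ = φ.comp (ψ.comp χ) :=
  ext_of_comm (fun x => Bicategory.Strict.assoc _ _ _) fun f => by
    constructor <;> intro i <;> simp [LooseTrans.comp, assoc_hom_eq, assoc_inv_eq]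

end LooseTrans

section

variable {hk : k' ≤ k} {M N P Q R : FFunctor S C}

theorem whisker_assoc' (φ : LooseTrans hk M N) {ψ ψ' : LooseTrans hk N P} (μ : ψ ⟶ ψ')
    (χ : LooseTrans hk P Q) :
    (Modification.wr (Modification.wl φ μ) χ : (φ.comp ψ).comp χ ⟶ (φ.comp ψ').comp χ) =
      eqToHom (LooseTrans.assoc' φ ψ χ) ≫
        (Modification.wl φ (Modification.wr μ χ) : φ.comp (ψ.comp χ) ⟶ φ.comp (ψ'.comp χ)) ≫
          eqToHom (LooseTrans.assoc' φ ψ' χ).symm :=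
  Modification.hom_ext fun x => by
    rw [Modification.conj_app]
    exact conj_mid (φ.app x) (Modification.app μ x) (χ.app x)

theorem id_whiskerLeft' {φ φ' : LooseTrans hk M N} (μ : φ ⟶ φ') :
    (Modification.wl (LooseTrans.id hk M) μ :
        (LooseTrans.id hk M).comp φ ⟶ (LooseTrans.id hk M).comp φ') =
      eqToHom (LooseTrans.id_comp' φ) ≫ μ ≫ eqToHom (LooseTrans.id_comp' φ').symm :=
  Modification.hom_ext fun x => by
    rw [Modification.conj_app]
    exact conj_id_left (Modification.app μ x)

theorem whiskerRight_id' {φ φ' : LooseTrans hk M N} (μ : φ ⟶ φ') :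
    (Modification.wr μ (LooseTrans.id hk N) :
        φ.comp (LooseTrans.id hk N) ⟶ φ'.comp (LooseTrans.id hk N)) =
      eqToHom (LooseTrans.comp_id' φ) ≫ μ ≫ eqToHom (LooseTrans.comp_id' φ').symm :=
  Modification.hom_ext fun x => by
    rw [Modification.conj_app]
    exact conj_id_right (Modification.app μ x)

theorem comp_whiskerLeft' (φ : LooseTrans hk M N) (ψ : LooseTrans hk N P)
    {χ χ' : LooseTrans hk P Q} (μ : χ ⟶ χ') :
    (Modification.wl (φ.comp ψ) μ : (φ.comp ψ).comp χ ⟶ (φ.comp ψ).comp χ') =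
      eqToHom (LooseTrans.assoc' φ ψ χ) ≫
        (Modification.wl φ (Modification.wl ψ μ) : φ.comp (ψ.comp χ) ⟶ φ.comp (ψ.comp χ')) ≫
          eqToHom (LooseTrans.assoc' φ ψ χ').symm :=
  Modification.hom_ext fun x => by
    rw [Modification.conj_app]
    exact conj_comp_left (φ.app x) (ψ.app x) (Modification.app μ x)

theorem whiskerRight_comp' {φ φ' : LooseTrans hk M N} (μ : φ ⟶ φ') (ψ : LooseTrans hk N P)
    (χ : LooseTrans hk P Q) :
    (Modification.wr μ (ψ.comp χ) : φ.comp (ψ.comp χ) ⟶ φ'.comp (ψ.comp χ)) =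
      eqToHom (LooseTrans.assoc' φ ψ χ).symm ≫
        (Modification.wr (Modification.wr μ ψ) χ : (φ.comp ψ).comp χ ⟶ (φ'.comp ψ).comp χ) ≫
          eqToHom (LooseTrans.assoc' φ' ψ χ) :=
  Modification.hom_ext fun x => by
    rw [Modification.conj_app]
    exact conj_comp_right (Modification.app μ x) (ψ.app x) (χ.app x)

theorem pentagon' (φ : LooseTrans hk M N) (ψ : LooseTrans hk N P) (χ : LooseTrans hk P Q)
    (ξ : LooseTrans hk Q R) :
    (Modification.wr (eqToHom (LooseTrans.assoc' φ ψ χ)) ξ :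
        ((φ.comp ψ).comp χ).comp ξ ⟶ (φ.comp (ψ.comp χ)).comp ξ) ≫
      eqToHom (LooseTrans.assoc' φ (ψ.comp χ) ξ) ≫
        (Modification.wl φ (eqToHom (LooseTrans.assoc' ψ χ ξ)) :
          φ.comp ((ψ.comp χ).comp ξ) ⟶ φ.comp (ψ.comp (χ.comp ξ))) =
      eqToHom (LooseTrans.assoc' (φ.comp ψ) χ ξ) ≫ eqToHom (LooseTrans.assoc' φ ψ (χ.comp ξ)) := by
  rw [Modification.wr_eqToHom, Modification.wl_eqToHom]
  simp

theorem triangle' (φ : LooseTrans hk M N) (ψ : LooseTrans hk N P) :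
    eqToHom (LooseTrans.assoc' φ (LooseTrans.id hk N) ψ) ≫
        (Modification.wl φ (eqToHom (LooseTrans.id_comp' ψ)) :
          φ.comp ((LooseTrans.id hk N).comp ψ) ⟶ φ.comp ψ) =
      (Modification.wr (eqToHom (LooseTrans.comp_id' φ)) ψ :
        (φ.comp (LooseTrans.id hk N)).comp ψ ⟶ φ.comp ψ) := by
  rw [Modification.wr_eqToHom, Modification.wl_eqToHom]
  simp

end

/-- The 2-category of `ℱ`-functors, loose `(k', k)`-natural transformations and modifications. -/
abbrev funBicategory (hk : k' ≤ k) (S C : FCat.{u, u, u}) : Bicategory.{u, u} (FFunctor S C) :=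
  { Hom := fun M N => LooseTrans hk M N
    id := fun M => LooseTrans.id hk M
    comp := fun φ ψ => φ.comp ψ
    whiskerLeft := fun φ _ _ μ => Modification.wl φ μ
    whiskerRight := fun μ χ => Modification.wr μ χ
    associator := fun φ ψ χ => eqToIso (LooseTrans.assoc' φ ψ χ)
    leftUnitor := fun φ => eqToIso (LooseTrans.id_comp' φ)
    rightUnitor := fun φ => eqToIso (LooseTrans.comp_id' φ)
    whiskerLeft_id := fun φ ψ => Modification.hom_ext fun x =>
      Bicategory.whiskerLeft_id (φ.app x) (ψ.app x)
    whiskerLeft_comp := fun φ _ _ _ μ ν => Modification.hom_ext fun x =>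
      Bicategory.whiskerLeft_comp (φ.app x) (Modification.app μ x) (Modification.app ν x)
    id_whiskerLeft := fun μ => id_whiskerLeft' (hk := hk) μ
    comp_whiskerLeft := fun φ ψ _ _ μ => comp_whiskerLeft' (hk := hk) φ ψ μ
    id_whiskerRight := fun φ ψ => Modification.hom_ext fun x =>
      Bicategory.id_whiskerRight (φ.app x) (ψ.app x)
    comp_whiskerRight := fun μ ν χ => Modification.hom_ext fun x =>
      Bicategory.comp_whiskerRight (Modification.app μ x) (Modification.app ν x) (χ.app x)
    whiskerRight_id := fun μ => whiskerRight_id' (hk := hk) μ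
    whiskerRight_comp := fun μ φ ψ => whiskerRight_comp' (hk := hk) μ φ ψ
    whisker_assoc := fun φ _ _ μ ψ => whisker_assoc' (hk := hk) φ μ ψ
    whisker_exchange := fun μ ν => Modification.hom_ext fun x =>
      Bicategory.whisker_exchange (Modification.app μ x) (Modification.app ν x)
    pentagon := fun φ ψ χ ξ => pentagon' (hk := hk) φ ψ χ ξ
    triangle := fun φ ψ => triangle' (hk := hk) φ ψ }

theorem funStrict (hk : k' ≤ k) (S C : FCat.{u, u, u}) :
    @Bicategory.Strict (FFunctor S C) (funBicategory hk S C) :=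
  letI := funBicategory hk S C
  { id_comp := fun {M N} φ => LooseTrans.id_comp' (hk := hk) (M := M) (N := N) φ
    comp_id := fun {M N} φ => LooseTrans.comp_id' (hk := hk) (M := M) (N := N) φ
    assoc := fun {M N P Q} φ ψ χ =>
      LooseTrans.assoc' (hk := hk) (M := M) (N := N) (P := P) (Q := Q) φ ψ χ
    leftUnitor_eqToIso := fun _ => rfl
    rightUnitor_eqToIso := fun _ => rfl
    associator_eqToIso := fun _ _ _ => rfl }

/-- The `ℱ`-category `Fun_{k', k}(S, C)` of `ℱ`-functors and loose `(k', k)`-natural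
transformations; a loose transformation is tight when its components are tight and all its
naturality cells are `k'`-cells. The 2-cells are modifications. -/
abbrev Fun (hk : k' ≤ k) (S C : FCat.{u, u, u}) : FCat.{u, u, u} where
  carrier := FFunctor S C
  bicategory := funBicategory hk S C
  strict := funStrict hk S C
  Tight φ := (∀ x, C.Tight (φ.app x)) ∧ ∀ {x y : S} (f : x ⟶ y), (φ.cell f).IsCell hk
  tight_id _ := ⟨fun _ => C.tight_id _, fun _ => Cell.isCell_ofEq hk _⟩
  tight_comp h h' := ⟨fun x => C.tight_comp (h.1 x) (h'.1 x), fun f => LooseTrans.isCell_compCell (h.2 f) (h'.2 f)⟩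

/-- The `ℱ`-category `Mod_{k', k}(S, C)` of models: the full sub-`ℱ`-category of
`Fun_{k', k}(S, C)` spanned by the models. -/
abbrev ModCat (hk : k' ≤ k) (S C : FSketch.{u}) : FCat.{u, u, u} :=
  (Fun hk S.cat C.cat).full (fun F : FFunctor S.cat C.cat => IsModel S C F)

/-- The `ℱ`-functor evaluating models at an object `x` of `S`. -/
def evalFunctor (hk : k' ≤ k) (S C : FSketch.{u}) (x : S.cat) :
    FFunctor (ModCat hk S C) C.cat where
  obj F := (F.1 : FFunctor S.cat C.cat).obj x
  map φ := LooseTrans.app φ x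
  map₂ μ := Modification.app μ x
  map₂_id _ := rfl
  map₂_comp _ _ := rfl
  map_id _ := rfl
  map_comp _ _ := rfl
  map₂_whisker_left φ _ _ μ := conj_refl (LooseTrans.app φ x ◁ Modification.app μ x)
  map₂_whisker_right μ φ := conj_refl (Modification.app μ x ▷ LooseTrans.app φ x)
  map_tight h := h.1 x

/-- The internal hom `Mod_{k', k}(S, C)` as an `ℱ`-sketch: its cones are those whose image under
every evaluation `ℱ`-functor is a cone of `C`. -/
def Mod (hk : k' ≤ k) (S C : FSketch.{u}) : FSketch.{u} where
  cat := ModCat hk S C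
  cones := {c | ∀ x : S.cat, c.map (evalFunctor hk S C x) ∈ C.cones}

end Fun

end Enhanced

open CategoryTheory Bicategory

namespace Enhanced

universe w v u w₁ v₁ u₁

/-! Both sides of the isomorphism encode the same data on pairs `(s, t)`, grouped in two ways. An
object `F` on the left gives objects `F(s)(t)`, 1-cells `F(σ)` at `t` and `F(s)(τ)`, and for each
pair `(σ, τ)` a square filled by the naturality cell of `F(σ)` at `τ`. Transposing exchanges the
horizontal and vertical sides of this square, hence the source and target of its filler, so a
`k.bar`-cell becomes a `k`-cell. This is `Cell.op`, and it is why the two weaknesses must be barred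
with respect to each other. The axioms then change places: functoriality of `F` in `S` becomes the
unit and composition laws of the transposed transformations, whose functoriality in `T` comes from
those laws for `F(σ)`. The modification axiom is exchanged with naturality of cells in 2-cells. The
two tightness clauses, one for `σ` and one for `τ`, also change places.

A loose morphism `φ` carries two families of squares: the cells of `φ` at `σ`, evaluated at `t`, and
the cells of its component at `s`, taken at `τ`. No square is reversed here, but the families
exchange roles: in one reading the cells at `σ` are modifications between `T`-transformations, in
the other the cells at `τ` are modifications between `S`-transformations. Both conditions assert the
commutativity of one cube of 2-cells for each `(σ, τ)`; `Cell.cube` makes this precise, with the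
directions in which cells exist taken into account. For tight morphisms one also needs that being a
`k'`-cell is a pointwise property (`Cell.isCell_of_eval`).

Cones in a sketch of models are tested by evaluation, so preservation of cones amounts to
interchanging quantifiers over `s` and `t`. Transposing twice gives back the original data, since
reversing a cell twice does. The construction is made for arbitrary weaknesses with `k = l.bar` and
`k' = l'.bar`, so that one functor serves for both directions. -/

namespace Cell

/-! ### Reversal of cells and commuting squares of 2-cells. -/

section

variable {B : Type u} [Bicategory.{w, v} B] {k k' l l' : Weakness} {x y z : B}

/-- A `k`-cell from `f` to `g` is the same as a `k.bar`-cell from `g` to `f`. -/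
@[simps]
def op (hl : l = k.bar) {f g : x ⟶ y} (χ : Cell k f g) : Cell l g f where
  fwd i := χ.bwd (by rintro rfl; exact i hl)
  bwd i := χ.fwd (by rintro rfl; exact i hl)
  fwd_bwd _ _ := χ.bwd_fwd _ _
  bwd_fwd _ _ := χ.fwd_bwd _ _
  eq_of_strict i := by
    subst i
    have hk : k = .strict := by cases k <;> first | rfl | cases hl
    subst hk
    obtain ⟨rfl, he⟩ := χ.eq_of_strict rfl
    -- The inverse of an identity 2-cell is an identity.
    have := χ.fwd_bwd (by rintro ⟨⟩) (by rintro ⟨⟩)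
    rw [he, eqToHom_refl, Category.id_comp] at this
    exact ⟨rfl, fun _ => this⟩

theorem op_ofEq (hl : l = k.bar) {f g : x ⟶ y} (e : f = g) :
    (ofEq e : Cell k f g).op hl = ofEq e.symm := rfl

theorem IsCell.op {hk : k' ≤ k} {hl : l' ≤ l} (h : l = k.bar) (h' : l' = k'.bar)
    {f g : x ⟶ y} {χ : Cell k f g} (hχ : χ.IsCell hk) : (χ.op h).IsCell hl := by
  obtain ⟨χ, rfl⟩ := hχ
  exact ⟨χ.op h', rfl⟩

theorem Comm.op (hl : l = k.bar) {f f' g g' : x ⟶ y} {α : f ⟶ f'} {β : g ⟶ g'} {χ : Cell k f g}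
    {ξ : Cell k f' g'} (h : Comm α β χ ξ) : Comm β α (χ.op hl) (ξ.op hl) :=
  ⟨fun _ => (h.2 _).symm, fun _ => (h.1 _).symm⟩

/-- The other equation has content only when the backward directions also exist; they are then
inverse to the forward ones, and conjugating by them turns one equation into the other. -/
theorem Comm.of_fwd {f f' g g' : x ⟶ y} {α : f ⟶ f'} {β : g ⟶ g'} {χ : Cell k f g}
    {ξ : Cell k f' g'} (hk : k ≠ .colax) (h : ∀ i, α ≫ ξ.fwd i = χ.fwd i ≫ β) :
    Comm α β χ ξ :=
  ⟨h, fun j => by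
    rw [← Category.comp_id α, ← ξ.fwd_bwd hk j, ← Category.assoc α, h, ← Category.assoc,
      ← Category.assoc, χ.bwd_fwd, Category.id_comp]⟩

theorem Comm.of_bwd {f f' g g' : x ⟶ y} {α : f ⟶ f'} {β : g ⟶ g'} {χ : Cell k f g}
    {ξ : Cell k f' g'} (hk : k ≠ .lax) (h : ∀ i, χ.bwd i ≫ α = β ≫ ξ.bwd i) :
    Comm α β χ ξ :=
  ⟨fun i => by
    rw [← Category.id_comp α, ← χ.fwd_bwd i hk, Category.assoc, Category.assoc,
      ← Category.assoc (χ.bwd hk), h, Category.assoc, ξ.bwd_fwd, Category.comp_id], h⟩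

/-- Used to see that the inverse of a modification is again a modification. -/
theorem Comm.inverse {f f' g g' : x ⟶ y} {α : f ⟶ f'} {α' : f' ⟶ f} {β : g ⟶ g'} {β' : g' ⟶ g}
    {χ : Cell k f g} {ξ : Cell k f' g'} (h : Comm α β χ ξ) (hα : α' ≫ α = 𝟙 _)
    (hα' : α ≫ α' = 𝟙 _) (hβ : β' ≫ β = 𝟙 _) (hβ' : β ≫ β' = 𝟙 _) : Comm α' β' ξ χ :=
  ⟨fun i => by
    rw [← Category.comp_id (χ.fwd i), ← hβ', ← Category.assoc (χ.fwd i), ← h.1,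
      Category.assoc, ← Category.assoc α', hα, Category.id_comp],
   fun i => by
    rw [← Category.id_comp (ξ.bwd i), ← hβ, Category.assoc, Category.assoc, ← Category.assoc β,
      ← h.2, Category.assoc, hα', Category.comp_id]⟩

theorem Comm.of_eq {f g : x ⟶ y} {α : f ⟶ f} {β : g ⟶ g} {χ ξ : Cell k f g} (hα : α = 𝟙 f)
    (hβ : β = 𝟙 g) (h : χ = ξ) : Comm α β χ ξ := by
  subst hα hβ h
  exact Comm.id χ

end

/-! ### Cubes -/

section

variable {B : Type u} [Bicategory.{w, v} B] [Bicategory.Strict B] {k l : Weakness}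
  {x₀ x₁ x₂ x₃ y₀ y₁ y₂ y₃ : B}
  {f : x₀ ⟶ y₀} {f₁ : x₁ ⟶ y₁} {f₂ : x₂ ⟶ y₂} {f₃ : x₃ ⟶ y₃}
  {p : x₀ ⟶ x₁} {p' : x₂ ⟶ x₃} {q : y₀ ⟶ y₁} {q' : y₂ ⟶ y₃}
  {s : x₀ ⟶ x₂} {s' : x₁ ⟶ x₃} {t : y₀ ⟶ y₂} {t' : y₁ ⟶ y₃}

/-- A cube whose faces are four `l`-cells and two `k`-cells (in the direction `s`), seen as a cube
whose faces are four `k`-cells and two `l`-cells (in the direction `p`). -/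
theorem cube (hl : l = k.bar)
    {A : Cell k (f ≫ t) (s ≫ f₂)} {A' : Cell k (f₁ ≫ t') (s' ≫ f₃)}
    {P : Cell l (f ≫ q) (p ≫ f₁)} {P' : Cell l (f₂ ≫ q') (p' ≫ f₃)}
    {Q : Cell l (s ≫ p') (p ≫ s')} {Q' : Cell l (t ≫ q') (q ≫ t')}
    (h₁ : ∀ i, Comm (A.fwd i ▷ q') (p ◁ A'.fwd i) (LooseTrans.compCell P Q')
      (LooseTrans.compCell Q P'))
    (h₂ : ∀ i, Comm (A.bwd i ▷ q') (p ◁ A'.bwd i) (LooseTrans.compCell Q P')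
      (LooseTrans.compCell P Q'))
    (hk : k = l.bar) :
    (∀ i, Comm (P.fwd i ▷ t') (s ◁ P'.fwd i) (LooseTrans.compCell A (Q'.op hk))
      (LooseTrans.compCell (Q.op hk) A')) ∧
    (∀ i, Comm (P.bwd i ▷ t') (s ◁ P'.bwd i) (LooseTrans.compCell (Q.op hk) A')
      (LooseTrans.compCell A (Q'.op hk))) := by
  constructor
  · intro i
    have hk' : k ≠ .lax := by rintro rfl; exact i hl
    refine Comm.of_bwd hk' fun j => ?_
    -- Both sides of the goal and of this equation paste the same six faces of the cube, with `A`
    -- taken backward and `P` forward; only the bracketing differs, and the `eqToHom` factors repair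
    -- it.
    have := (h₂ j).1 i
    simpa using congrArg (fun τ => eqToHom (Bicategory.Strict.assoc s f₂ q').symm ≫ τ ≫
      eqToHom (Bicategory.Strict.assoc p f₁ t').symm) this
  · intro i
    have hk' : k ≠ .colax := by rintro rfl; exact i hl
    refine Comm.of_fwd hk' fun j => ?_
    -- The opposite choice of directions: `A` forward and `P` backward.
    have := (h₁ j).2 i
    simpa using congrArg (fun τ => eqToHom (Bicategory.Strict.assoc p f₁ t') ≫ τ ≫
      eqToHom (Bicategory.Strict.assoc s f₂ q')) this

end

end Cell

variable {k k' l l' : Weakness} {hk : k' ≤ k} {hl : l' ≤ l} {S T C : FSketch.{u}}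

/-! ### Components and naturality cells of morphisms of models. -/

namespace Mod

/-- The `ℱ`-functor underlying a model. -/
def functor (M : (Mod hl T C).cat) : FFunctor T.cat C.cat := M.1

variable {M N P : (Mod hl T C).cat}

/-- The components of a morphism of models. -/
def app (φ : M ⟶ N) (t : T.cat) : (functor M).obj t ⟶ (functor N).obj t := LooseTrans.app φ t

/-- The naturality cells of a morphism of models. -/
def cell (φ : M ⟶ N) {t t' : T.cat} (τ : t ⟶ t') :
    Cell l (app φ t ≫ (functor N).map τ) ((functor M).map τ ≫ app φ t') :=
  LooseTrans.cell φ τ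

/-- The components of a 2-cell between morphisms of models. -/
def app₂ {φ ψ : M ⟶ N} (μ : φ ⟶ ψ) (t : T.cat) : app φ t ⟶ app ψ t := Modification.app μ t

theorem app₂_comm {φ ψ : M ⟶ N} (μ : φ ⟶ ψ) {t t' : T.cat} (τ : t ⟶ t') :
    Cell.Comm (app₂ μ t ▷ (functor N).map τ) ((functor M).map τ ◁ app₂ μ t') (cell φ τ)
      (cell ψ τ) :=
  Modification.comm μ τ

theorem hom₂_ext {φ ψ : M ⟶ N} {μ ν : φ ⟶ ψ} (h : ∀ t, app₂ μ t = app₂ ν t) : μ = ν :=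
  Modification.hom_ext h

theorem app_id (M : (Mod hl T C).cat) (t : T.cat) : app (𝟙 M) t = 𝟙 _ := rfl

theorem app_comp (φ : M ⟶ N) (ψ : N ⟶ P) (t : T.cat) : app (φ ≫ ψ) t = app φ t ≫ app ψ t := rfl

/-- Equal morphisms have cells in different types, so a rewrite along `F.map_id` or `F.map_comp`
must carry identity cells on both sides. -/
theorem cell_congr {φ ψ : M ⟶ N} (e : φ = ψ) {t t' : T.cat} (τ : t ⟶ t') :
    cell φ τ = (Cell.ofEq (by rw [e])).trans ((cell ψ τ).trans (Cell.ofEq (by rw [e]))) := by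
  subst e
  ext <;> simp

theorem cell_id (M : (Mod hl T C).cat) {t t' : T.cat} (τ : t ⟶ t') :
    cell (𝟙 M) τ = Cell.ofEq (by
      rw [app_id, app_id, Bicategory.Strict.id_comp, Bicategory.Strict.comp_id]) := rfl

theorem cell_comp (φ : M ⟶ N) (ψ : N ⟶ P) {t t' : T.cat} (τ : t ⟶ t') :
    cell (φ ≫ ψ) τ = (Cell.ofEq (by rw [app_comp, Bicategory.Strict.assoc])).trans
      (((cell ψ τ).wl (app φ t)).trans ((Cell.ofEq (Bicategory.Strict.assoc _ _ _).symm).trans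
        (((cell φ τ).wr (app ψ t')).trans
          (Cell.ofEq (by rw [app_comp, Bicategory.Strict.assoc]))))) := rfl

/-- The unit law of `φ` in `T`, in the form that makes the transpose preserve identities. -/
theorem comm_op_cell_id (h : k = l.bar) (φ : M ⟶ N) (t : T.cat) :
    Cell.Comm (eqToHom ((functor M).map_id t) ▷ app φ t) (app φ t ◁ eqToHom ((functor N).map_id t))
      ((cell φ (𝟙 t)).op h) (Cell.ofEq
        ((Bicategory.Strict.id_comp _).trans (Bicategory.Strict.comp_id _).symm)) := by
  have e : cell φ (𝟙 t) = Cell.ofEq (by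
      rw [(functor M).map_id, (functor N).map_id, Bicategory.Strict.id_comp,
        Bicategory.Strict.comp_id]) :=
    LooseTrans.cell_id φ t
  rw [e, Cell.op_ofEq]
  exact Cell.Comm.ofEq (by simp)

/-- After reversal, the composition law of a transformation along `τ` and `τ'` becomes the pasting
that defines composition of transformations; hence the transpose preserves composition. -/
theorem comm_op_cell_comp (h : k = l.bar) (φ : M ⟶ N) {t t' t'' : T.cat} (τ : t ⟶ t')
    (τ' : t' ⟶ t'') :
    Cell.Comm (eqToHom ((functor M).map_comp τ τ') ▷ app φ t'')
      (app φ t ◁ eqToHom ((functor N).map_comp τ τ')) ((cell φ (τ ≫ τ')).op h)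
      (LooseTrans.compCell ((cell φ τ).op h) ((cell φ τ').op h)) := by
  have e : cell φ (τ ≫ τ') =
    (Cell.ofEq (by rw [(functor N).map_comp, Bicategory.Strict.assoc])).trans
      (((cell φ τ).wr ((functor N).map τ')).trans
        ((Cell.ofEq (Bicategory.Strict.assoc _ _ _)).trans
          (((cell φ τ').wl ((functor M).map τ)).trans
            (Cell.ofEq (by rw [(functor M).map_comp, Bicategory.Strict.assoc]))))) :=
    LooseTrans.cell_comp φ τ τ'
  rw [e]
  constructor <;> intro i <;> simp

theorem app₂_conj {φ φ' ψ ψ' : M ⟶ N} (e : φ = φ') (μ : φ' ⟶ ψ') (e' : ψ' = ψ) (t : T.cat) :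
    app₂ (eqToHom e ≫ μ ≫ eqToHom e') t =
      eqToHom (by rw [e]) ≫ app₂ μ t ≫ eqToHom (by rw [e']) := by
  subst e e'
  simp

theorem cell_map_id (F : FFunctor S.cat (Mod hl T C).cat) (s : S.cat) {t t' : T.cat}
    (τ : t ⟶ t') : cell (F.map (𝟙 s)) τ = Cell.ofEq (by
      rw [F.map_id, app_id, app_id, Bicategory.Strict.id_comp, Bicategory.Strict.comp_id]) := by
  rw [cell_congr (F.map_id s), cell_id]
  ext <;> simp

/-- The converse exchange: pasting, which composes transformations, becomes after reversal the
composition law required of the transposed transformation. -/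
theorem op_cell_map_comp (h : k = l.bar) (F : FFunctor S.cat (Mod hl T C).cat) {s s' s'' : S.cat}
    (σ : s ⟶ s') (σ' : s' ⟶ s'') {t t' : T.cat} (τ : t ⟶ t') :
    (cell (F.map (σ ≫ σ')) τ).op h =
      (Cell.ofEq (by rw [F.map_comp, app_comp, Bicategory.Strict.assoc])).trans
        ((((cell (F.map σ) τ).op h).wr (app (F.map σ') t')).trans
          ((Cell.ofEq (Bicategory.Strict.assoc _ _ _)).trans
            ((((cell (F.map σ') τ).op h).wl (app (F.map σ) t)).trans
              (Cell.ofEq (by rw [F.map_comp, app_comp, Bicategory.Strict.assoc]))))) := by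
  rw [cell_congr (F.map_comp σ σ'), cell_comp]
  ext <;> simp

/-- The evaluation of models at `t`, as an `ℱ`-functor on the internal hom. -/
abbrev eval (hl : l' ≤ l) (T C : FSketch.{u}) (t : T.cat) : FFunctor (Mod hl T C).cat C.cat :=
  evalFunctor hl T C t

theorem hom_ext {φ ψ : M ⟶ N} (e : ∀ t, app φ t = app ψ t)
    (h : ∀ {t t' : T.cat} (τ : t ⟶ t'), Cell.Comm (eqToHom (e t) ▷ (functor N).map τ)
      ((functor M).map τ ◁ eqToHom (e t')) (cell φ τ) (cell ψ τ)) : φ = ψ :=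
  LooseTrans.ext_of_comm e h

end Mod

/-! ### Cells between morphisms of models, componentwise. -/

namespace Cell

variable {M N P : (Mod hl T C).cat}

/-- The component at `t` of a cell between morphisms of models. -/
def eval {φ ψ : M ⟶ N} (χ : Cell k φ ψ) (t : T.cat) : Cell k (Mod.app φ t) (Mod.app ψ t) where
  fwd i := Mod.app₂ (χ.fwd i) t
  bwd i := Mod.app₂ (χ.bwd i) t
  fwd_bwd i j := congrArg (fun μ => Mod.app₂ μ t) (χ.fwd_bwd i j)
  bwd_fwd i j := congrArg (fun μ => Mod.app₂ μ t) (χ.bwd_fwd i j)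
  eq_of_strict hk := by
    obtain ⟨rfl, he⟩ := χ.eq_of_strict hk
    exact ⟨rfl, fun i => congrArg (fun μ => Mod.app₂ μ t) (he i)⟩

theorem eval_ofEq {φ ψ : M ⟶ N} (e : φ = ψ) (t : T.cat) :
    (ofEq e : Cell k φ ψ).eval t = ofEq (by rw [e]) := by
  subst e
  rfl

theorem IsCell.eval {φ ψ : M ⟶ N} {χ : Cell k φ ψ} (h : χ.IsCell hk) (t : T.cat) :
    (χ.eval t).IsCell hk := by
  obtain ⟨χ, rfl⟩ := h
  exact ⟨χ.eval t, rfl⟩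

theorem Comm.eval {φ φ' ψ ψ' : M ⟶ N} {α : φ ⟶ φ'} {β : ψ ⟶ ψ'} {χ : Cell k φ ψ}
    {ξ : Cell k φ' ψ'} (h : Comm α β χ ξ) (t : T.cat) :
    Comm (Mod.app₂ α t) (Mod.app₂ β t) (χ.eval t) (ξ.eval t) :=
  ⟨fun i => congrArg (fun μ => Mod.app₂ μ t) (h.1 i),
   fun i => congrArg (fun μ => Mod.app₂ μ t) (h.2 i)⟩

theorem eval_ext {φ ψ : M ⟶ N} {χ ξ : Cell k φ ψ} (h : ∀ t, χ.eval t = ξ.eval t) : χ = ξ := by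
  ext i
  · exact Mod.hom₂_ext fun t => congrArg (fun χ => χ.fwd i) (h t)
  · exact Mod.hom₂_ext fun t => congrArg (fun χ => χ.bwd i) (h t)

theorem Comm.of_eval {φ φ' ψ ψ' : M ⟶ N} {α : φ ⟶ φ'} {β : ψ ⟶ ψ'} {χ : Cell k φ ψ}
    {ξ : Cell k φ' ψ'} (h : ∀ t, Comm (Mod.app₂ α t) (Mod.app₂ β t) (χ.eval t)
      (ξ.eval t)) : Comm α β χ ξ :=
  ⟨fun i => Mod.hom₂_ext fun t => (h t).1 i, fun i => Mod.hom₂_ext fun t => (h t).2 i⟩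

/-- A cell between morphisms of models, given by its components. -/
def ofApp {φ ψ : M ⟶ N} (χ : ∀ t, Cell k (Mod.app φ t) (Mod.app ψ t))
    (h : ∀ i {t t' : T.cat} (f : t ⟶ t'), Comm ((χ t).fwd i ▷ (Mod.functor N).map f)
      ((Mod.functor M).map f ◁ (χ t').fwd i) (Mod.cell φ f) (Mod.cell ψ f))
    (h' : ∀ i {t t' : T.cat} (f : t ⟶ t'), Comm ((χ t).bwd i ▷ (Mod.functor N).map f)
      ((Mod.functor M).map f ◁ (χ t').bwd i) (Mod.cell ψ f) (Mod.cell φ f)) : Cell k φ ψ where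
  fwd i := ⟨fun t => (χ t).fwd i, h i⟩
  bwd i := ⟨fun t => (χ t).bwd i, h' i⟩
  fwd_bwd i j := Mod.hom₂_ext fun t => (χ t).fwd_bwd i j
  bwd_fwd i j := Mod.hom₂_ext fun t => (χ t).bwd_fwd i j
  eq_of_strict hs := by
    choose e he using fun t => (χ t).eq_of_strict hs
    have hk : k ≠ .colax := by rw [hs]; rintro ⟨⟩
    -- In the strict case the components of `φ` and `ψ` coincide through identity 2-cells, and `h`
    -- then says that their naturality cells coincide too.
    obtain rfl : φ = ψ := Mod.hom_ext e fun f => by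
      rw [← he _ hk, ← he _ hk]
      exact h hk f
    exact ⟨rfl, fun i => Mod.hom₂_ext fun t => he t i⟩

/-- A `k'`-cell may have a direction that `χ` lacks, and its components must be shown to form a
modification. They are inverse to the components of the direction that `χ` has, which is a
modification already. -/
theorem isCell_of_eval {φ ψ : M ⟶ N} {χ : Cell k φ ψ} (hχ : ∀ t, (χ.eval t).IsCell hk) :
    χ.IsCell hk := by
  choose ξ hξ using hχ
  have hf t i : (ξ t).fwd (Weakness.ne_colax hk i) = Mod.app₂ (χ.fwd i) t :=
    congrArg (fun χ => χ.fwd i) (hξ t)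
  have hb t i : (ξ t).bwd (Weakness.ne_lax hk i) = Mod.app₂ (χ.bwd i) t :=
    congrArg (fun χ => χ.bwd i) (hξ t)
  have hc : k ≠ .colax ∨ k ≠ .lax := by cases k <;> simp
  refine ⟨ofApp ξ (fun i _ _ f => ?_) (fun i _ _ f => ?_), eval_ext hξ⟩
  · by_cases hk' : k = .colax
    -- Here `χ` only goes backward, so the forward components of `ξ` are treated as inverses of
    -- `χ.bwd`.
    · have hk' : k ≠ .lax := hc.resolve_left (not_not.2 hk')
      have := Mod.app₂_comm (χ.bwd hk') f
      rw [← hb, ← hb] at this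
      refine this.inverse ?_ ?_ ?_ ?_ <;>
        simp only [← comp_whiskerRight, ← whiskerLeft_comp, fwd_bwd, bwd_fwd, id_whiskerRight,
          Bicategory.whiskerLeft_id]
    · have := Mod.app₂_comm (χ.fwd hk') f
      rwa [← hf, ← hf] at this
  · by_cases hk' : k = .lax
    · have hk' : k ≠ .colax := hc.resolve_right (not_not.2 hk')
      have := Mod.app₂_comm (χ.fwd hk') f
      rw [← hf, ← hf] at this
      refine this.inverse ?_ ?_ ?_ ?_ <;>
        simp only [← comp_whiskerRight, ← whiskerLeft_comp, fwd_bwd, bwd_fwd, id_whiskerRight,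
          Bicategory.whiskerLeft_id]
    · have := Mod.app₂_comm (χ.bwd hk') f
      rwa [← hb, ← hb] at this

end Cell

/-! ### The transpose -/

section Swap

/-- The transpose of an `ℱ`-functor at a morphism. -/
def swapMap (h : k = l.bar) (h' : k' = l'.bar) (F : FFunctor S.cat (Mod hl T C).cat)
    {t t' : T.cat} (τ : t ⟶ t') :
    LooseTrans hk (F.comp (Mod.eval hl T C t)) (F.comp (Mod.eval hl T C t')) where
  app s := (Mod.functor (F.obj s)).map τ
  cell σ := (Mod.cell (F.map σ) τ).op h
  -- For tight `σ` the morphism `F(σ)` is tight, so all its naturality cells are `l'`-cells, whether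
  -- or not `τ` is tight.
  cell_tight hσ := ((F.map_tight hσ).2 τ).op h h'
  cell_naturality η := (Mod.app₂_comm (F.map₂ η) τ).op h
  cell_id s := congrArg (Cell.op h) (Mod.cell_map_id F s τ)
  cell_comp σ σ' := Mod.op_cell_map_comp h F σ σ' τ

theorem swapMap_id (h : k = l.bar) (h' : k' = l'.bar) (F : FFunctor S.cat (Mod hl T C).cat)
    (t : T.cat) : swapMap h h' F (𝟙 t) = LooseTrans.id hk (F.comp (Mod.eval hl T C t)) :=
  LooseTrans.ext_of_comm (fun s => (Mod.functor (F.obj s)).map_id t) fun σ =>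
    Mod.comm_op_cell_id h (F.map σ) t

theorem swapMap_comp (h : k = l.bar) (h' : k' = l'.bar) (F : FFunctor S.cat (Mod hl T C).cat)
    {t t' t'' : T.cat} (τ : t ⟶ t') (τ' : t' ⟶ t'') :
    swapMap h h' F (τ ≫ τ') =
      (swapMap h h' F τ : LooseTrans hk _ _).comp (swapMap h h' F τ') :=
  LooseTrans.ext_of_comm (fun s => (Mod.functor (F.obj s)).map_comp τ τ') fun σ =>
    Mod.comm_op_cell_comp h (F.map σ) τ τ'

/-- The transpose of an `ℱ`-functor. -/
def swap (hk : k' ≤ k) (h : k = l.bar) (h' : k' = l'.bar) (F : FFunctor S.cat (Mod hl T C).cat)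
    (hF : ∀ t, IsModel S C (F.comp (Mod.eval hl T C t))) :
    FFunctor T.cat (Mod hk S C).cat where
  obj t := ⟨F.comp (Mod.eval hl T C t), hF t⟩
  map τ := swapMap h h' F τ
  map₂ θ :=
    { app := fun s => (Mod.functor (F.obj s)).map₂ θ
      -- Naturality of the cells of `F(σ)` in the 2-cell `θ` is the modification axiom at `σ`.
      comm := fun σ => (LooseTrans.cell_naturality (F.map σ) θ).op h }
  map₂_id τ := Modification.hom_ext fun s => (Mod.functor (F.obj s)).map₂_id τ
  map₂_comp θ θ' := Modification.hom_ext fun s => (Mod.functor (F.obj s)).map₂_comp θ θ'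
  map_id t := swapMap_id h h' F t
  map_comp τ τ' := swapMap_comp h h' F τ τ'
  map₂_whisker_left τ _ _ θ := Modification.hom_ext fun s => by
    refine Eq.trans ?_ (Mod.app₂_conj _ _ _ s).symm
    exact (Mod.functor (F.obj s)).map₂_whisker_left τ θ
  map₂_whisker_right θ τ := Modification.hom_ext fun s => by
    refine Eq.trans ?_ (Mod.app₂_conj _ _ _ s).symm
    exact (Mod.functor (F.obj s)).map₂_whisker_right θ τ
  -- For tight `τ` every loose `F(σ)` has an `l'`-cell at `τ`, which is the cell condition for
  -- tightness of the transposed morphism.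
  map_tight hτ := ⟨fun s => (Mod.functor (F.obj s)).map_tight hτ,
    fun σ => (LooseTrans.cell_tight (F.map σ) hτ).op h h'⟩

end Swap

/-- Symmetry of the relation between the two weaknesses, so that the transpose can be applied in the
reverse direction. -/
theorem Weakness.eq_bar (h : k = l.bar) : l = k.bar := by
  subst h
  cases l <;> rfl

namespace Cell

variable {M N P M' N' P' : (Mod hl T C).cat}

theorem eval_trans {φ ψ χ : M ⟶ N} (A : Cell k φ ψ) (B : Cell k ψ χ) (t : T.cat) :
    (A.trans B).eval t = (A.eval t).trans (B.eval t) := rfl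

theorem eval_compCell {a : M ⟶ M'} {b : N ⟶ N'} {c : P ⟶ P'} {f : M ⟶ N} {g : N ⟶ P}
    {f' : M' ⟶ N'} {g' : N' ⟶ P'} (χ : Cell k (f ≫ b) (a ≫ f')) (ξ : Cell k (g ≫ c) (b ≫ g'))
    (t : T.cat) : (LooseTrans.compCell χ ξ).eval t =
      (LooseTrans.compCell
        (χ.eval t : Cell k (Mod.app f t ≫ Mod.app b t) (Mod.app a t ≫ Mod.app f' t))
        (ξ.eval t : Cell k (Mod.app g t ≫ Mod.app c t) (Mod.app b t ≫ Mod.app g' t))) := by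
  unfold LooseTrans.compCell
  rw [eval_trans, eval_trans, eval_trans, eval_trans, eval_ofEq, eval_ofEq, eval_ofEq]
  rfl

end Cell

/-! ### Transposing transformations and modifications. -/

section Swap

variable {F F' F'' : FFunctor S.cat (Mod hl T C).cat}

/-- The transpose of a transformation at an object. -/
def swapApp (φ : LooseTrans hk F F') (t : T.cat) :
    LooseTrans hk (F.comp (Mod.eval hl T C t)) (F'.comp (Mod.eval hl T C t)) where
  app s := Mod.app (φ.app s) t
  cell σ := (φ.cell σ).eval t
  cell_tight hσ := (φ.cell_tight hσ).eval t
  cell_naturality η := (φ.cell_naturality η).eval t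
  cell_id s := (congrArg (fun χ => Cell.eval χ t) (φ.cell_id s)).trans (Cell.eval_ofEq _ t)
  cell_comp σ σ' := by
    refine (congrArg (fun χ => Cell.eval χ t) (φ.cell_comp σ σ')).trans ?_
    rw [Cell.eval_trans, Cell.eval_trans, Cell.eval_trans, Cell.eval_trans, Cell.eval_ofEq,
      Cell.eval_ofEq, Cell.eval_ofEq]
    rfl

variable (h : k = l.bar) (h' : k' = l'.bar)
  {hF : ∀ t, IsModel S C (F.comp (Mod.eval hl T C t))}
  {hF' : ∀ t, IsModel S C (F'.comp (Mod.eval hl T C t))}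
  {hF'' : ∀ t, IsModel S C (F''.comp (Mod.eval hl T C t))}

/-- The cell of `φ` at `σ` consists of modifications; their axiom at `τ` is the cube hypothesis, and
the conclusion is the modification axiom at `σ` for the cells at `τ`. -/
theorem swap_cube (φ : LooseTrans hk F F') {s s' : S.cat} (σ : s ⟶ s') {t t' : T.cat}
    (τ : t ⟶ t') :
    (∀ i, Cell.Comm ((Mod.cell (φ.app s) τ).fwd i ▷ Mod.app (F'.map σ) t')
      (Mod.app (F.map σ) t ◁ (Mod.cell (φ.app s') τ).fwd i)
      (LooseTrans.compCell ((swapApp φ t).cell σ) ((Mod.cell (F'.map σ) τ).op h))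
      (LooseTrans.compCell ((Mod.cell (F.map σ) τ).op h) ((swapApp φ t').cell σ))) ∧
    (∀ i, Cell.Comm ((Mod.cell (φ.app s) τ).bwd i ▷ Mod.app (F'.map σ) t')
      (Mod.app (F.map σ) t ◁ (Mod.cell (φ.app s') τ).bwd i)
      (LooseTrans.compCell ((Mod.cell (F.map σ) τ).op h) ((swapApp φ t').cell σ))
      (LooseTrans.compCell ((swapApp φ t).cell σ) ((Mod.cell (F'.map σ) τ).op h))) :=
  Cell.cube (Weakness.eq_bar h) (A := (φ.cell σ).eval t) (A' := (φ.cell σ).eval t')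
    (P := Mod.cell (φ.app s) τ) (P' := Mod.cell (φ.app s') τ) (Q := Mod.cell (F.map σ) τ)
    (Q' := Mod.cell (F'.map σ) τ) (fun i => Mod.app₂_comm ((φ.cell σ).fwd i) τ)
    (fun i => Mod.app₂_comm ((φ.cell σ).bwd i) τ) h

/-- The naturality cells of the transpose of a transformation. -/
def swapCell (φ : LooseTrans hk F F') {t t' : T.cat} (τ : t ⟶ t') :
    Cell l (x := (swap hk h h' F hF).obj t) (y := (swap hk h h' F' hF').obj t')
      ((swapApp φ t : (swap hk h h' F hF).obj t ⟶ (swap hk h h' F' hF').obj t) ≫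
        (swap hk h h' F' hF').map τ)
      ((swap hk h h' F hF).map τ ≫
        (swapApp φ t' : (swap hk h h' F hF).obj t' ⟶ (swap hk h h' F' hF').obj t')) :=
  Cell.ofApp (fun s => Mod.cell (φ.app s) τ) (fun i _ _ σ => (swap_cube h φ σ τ).1 i)
    (fun i _ _ σ => (swap_cube h φ σ τ).2 i)

/-- The transpose of a transformation. -/
def swapTrans (φ : LooseTrans hk F F') :
    LooseTrans hl (swap hk h h' F hF) (swap hk h h' F' hF') where
  app t := swapApp φ t
  cell τ := swapCell h h' φ τ
  cell_tight hτ := Cell.isCell_of_eval fun s => LooseTrans.cell_tight (φ.app s) hτ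
  cell_naturality θ := Cell.Comm.of_eval fun s => LooseTrans.cell_naturality (φ.app s) θ
  cell_id t := Cell.eval_ext fun s => by
    refine (LooseTrans.cell_id (φ.app s) t).trans ?_
    rw [Cell.eval_ofEq]
    rfl
  cell_comp τ τ' := Cell.eval_ext fun s => by
    refine (LooseTrans.cell_comp (φ.app s) τ τ').trans ?_
    rw [Cell.eval_trans, Cell.eval_trans, Cell.eval_trans, Cell.eval_trans, Cell.eval_ofEq,
      Cell.eval_ofEq, Cell.eval_ofEq]
    rfl

/-- The transpose of a modification. -/
def swapMod {φ ψ : LooseTrans hk F F'} (μ : Modification φ ψ) :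
    Modification (swapTrans h h' φ : LooseTrans hl (swap hk h h' F hF) (swap hk h h' F' hF'))
      (swapTrans h h' ψ) where
  app t :=
    { app := fun s => Mod.app₂ (μ.app s) t
      comm := fun σ => (μ.comm σ).eval t }
  comm τ := Cell.Comm.of_eval fun s => Mod.app₂_comm (μ.app s) τ

end Swap

namespace Mod

variable {M N P : (Mod hl T C).cat}

theorem app₂_eqToHom_wr {φ ψ : M ⟶ N} (e : φ = ψ) (χ : N ⟶ P) (t : T.cat) :
    app₂ (eqToHom e ▷ χ) t = eqToHom (by rw [e]) := by
  subst e
  exact id_whiskerRight _ _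

theorem app₂_wl_eqToHom (χ : M ⟶ N) {φ ψ : N ⟶ P} (e : φ = ψ) (t : T.cat) :
    app₂ (χ ◁ eqToHom e) t = eqToHom (by rw [e]) := by
  subst e
  exact Bicategory.whiskerLeft_id _ _

theorem eval_cell_id (G : FFunctor S.cat (Mod hl T C).cat) {s s' : S.cat} (σ : s ⟶ s')
    (t : T.cat) : ((LooseTrans.id hk G).cell σ).eval t =
      Cell.ofEq (congrArg (app · t)
        ((Bicategory.Strict.id_comp _).trans (Bicategory.Strict.comp_id _).symm)) :=
  Cell.eval_ofEq _ t

end Mod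

/-! ### Functoriality of the transpose. -/

section Swap

variable {F F' F'' : FFunctor S.cat (Mod hl T C).cat} (h : k = l.bar) (h' : k' = l'.bar)
  {hF : ∀ t, IsModel S C (F.comp (Mod.eval hl T C t))}
  {hF' : ∀ t, IsModel S C (F'.comp (Mod.eval hl T C t))}
  {hF'' : ∀ t, IsModel S C (F''.comp (Mod.eval hl T C t))}

theorem swapApp_id (t : T.cat) :
    swapApp (LooseTrans.id hk F) t = LooseTrans.id hk (F.comp (Mod.eval hl T C t)) :=
  LooseTrans.ext_of_comm (fun _ => rfl) fun _ =>
    Cell.Comm.of_eq (id_whiskerRight _ _) (Bicategory.whiskerLeft_id _ _) (Cell.eval_ofEq _ t)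

theorem swapApp_comp (φ : LooseTrans hk F F') (ψ : LooseTrans hk F' F'') (t : T.cat) :
    swapApp (φ.comp ψ) t = (swapApp φ t).comp (swapApp ψ t) :=
  LooseTrans.ext_of_comm (fun _ => rfl) fun σ =>
    Cell.Comm.of_eq (id_whiskerRight _ _) (Bicategory.whiskerLeft_id _ _)
      (Cell.eval_compCell (φ.cell σ) (ψ.cell σ) t)

theorem swapTrans_id :
    swapTrans h h' (LooseTrans.id hk F) = LooseTrans.id hl (swap hk h h' F hF) := by
  refine LooseTrans.ext_of_comm (fun t => swapApp_id t) fun τ => ?_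
  -- The equality of components over `t` leaves coherence 2-cells in the square; at each `s` they
  -- are identities, so only equality of the evaluated cells remains.
  refine Cell.Comm.of_eval fun s => Cell.Comm.of_eq (Mod.app₂_eqToHom_wr _ _ s)
      (Mod.app₂_wl_eqToHom _ _ s) ?_
  exact (Mod.eval_cell_id (swap hk h h' F hF) τ s).symm

theorem swapTrans_comp (φ : LooseTrans hk F F') (ψ : LooseTrans hk F' F'') :
    (swapTrans h h' (φ.comp ψ) : LooseTrans hl (swap hk h h' F hF) (swap hk h h' F'' hF'')) =
      (swapTrans h h' φ : LooseTrans hl _ (swap hk h h' F' hF')).comp (swapTrans h h' ψ) := by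
  refine LooseTrans.ext_of_comm (fun t => swapApp_comp φ ψ t) fun τ => ?_
  refine Cell.Comm.of_eval fun s => Cell.Comm.of_eq (Mod.app₂_eqToHom_wr _ _ s)
      (Mod.app₂_wl_eqToHom _ _ s) ?_
  refine Eq.trans ?_ (Cell.eval_compCell (swapCell h h' φ τ) (swapCell h h' ψ τ) s).symm
  rfl

/-- The transpose of a model. -/
def swapObj (h : k = l.bar) (h' : k' = l'.bar) (F : (Mod hk S (Mod hl T C)).cat) :
    (Mod hl T (Mod hk S C)).cat :=
  -- The cones of `S` are handled because `F` is a model whose target cones are tested at each `t`;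
  -- those of `T` because each `F(s)` is a model.
  ⟨swap hk h h' F.1 fun t c hc => F.2 c hc t, fun d hd s => (F.1.obj s).2 d hd⟩

/-- The transpose of a morphism of models. -/
def swapHom {F G : (Mod hk S (Mod hl T C)).cat} (φ : F ⟶ G) : swapObj h h' F ⟶ swapObj h h' G :=
  swapTrans h h' φ

/-- The transpose of a 2-cell between morphisms of models. -/
def swapHom₂ {F G : (Mod hk S (Mod hl T C)).cat} {φ ψ : F ⟶ G} (μ : φ ⟶ ψ) :
    swapHom h h' φ ⟶ swapHom h h' ψ :=
  swapMod h h' μ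

theorem swapHom_id (F : (Mod hk S (Mod hl T C)).cat) : swapHom h h' (𝟙 F) = 𝟙 (swapObj h h' F) :=
  swapTrans_id h h'

theorem swapHom_comp {F G H : (Mod hk S (Mod hl T C)).cat} (φ : F ⟶ G) (ψ : G ⟶ H) :
    swapHom h h' (φ ≫ ψ) = swapHom h h' φ ≫ swapHom h h' ψ :=
  swapTrans_comp h h' φ ψ

theorem swapHom₂_whiskerLeft {F G H : (Mod hk S (Mod hl T C)).cat} (φ : F ⟶ G) {ψ χ : G ⟶ H}
    (μ : ψ ⟶ χ) :
    swapHom₂ h h' (φ ◁ μ) = eqToHom (swapHom_comp h h' φ ψ) ≫ swapHom h h' φ ◁ swapHom₂ h h' μ ≫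
      eqToHom (swapHom_comp h h' φ χ).symm :=
  Mod.hom₂_ext fun t => by
    rw [Mod.app₂_conj]
    refine Mod.hom₂_ext fun s => ?_
    rw [Mod.app₂_conj]
    -- Evaluated at `t` and then `s`, the coherence 2-cells join definitionally equal 1-cells and
    -- disappear.
    exact conj_refl _

theorem swapHom₂_whiskerRight {F G H : (Mod hk S (Mod hl T C)).cat} {φ ψ : F ⟶ G} (μ : φ ⟶ ψ)
    (χ : G ⟶ H) :
    swapHom₂ h h' (μ ▷ χ) = eqToHom (swapHom_comp h h' φ χ) ≫ swapHom₂ h h' μ ▷ swapHom h h' χ ≫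
      eqToHom (swapHom_comp h h' ψ χ).symm :=
  Mod.hom₂_ext fun t => by
    rw [Mod.app₂_conj]
    refine Mod.hom₂_ext fun s => ?_
    rw [Mod.app₂_conj]
    exact conj_refl _

/-- The transpose, as an `ℱ`-functor. -/
def swapFunctor (hk : k' ≤ k) (hl : l' ≤ l) (h : k = l.bar) (h' : k' = l'.bar)
    (S T C : FSketch.{u}) :
    FFunctor (Mod hk S (Mod hl T C)).cat (Mod hl T (Mod hk S C)).cat where
  obj F := swapObj h h' F
  map φ := swapHom h h' φ
  map₂ μ := swapHom₂ h h' μ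
  map₂_id _ := rfl
  map₂_comp _ _ := rfl
  map_id F := swapHom_id h h' F
  map_comp φ ψ := swapHom_comp h h' φ ψ
  map₂_whisker_left φ _ _ μ := swapHom₂_whiskerLeft h h' φ μ
  map₂_whisker_right μ φ := swapHom₂_whiskerRight h h' μ φ
  -- Tightness on either side says that all components at `(s, t)` are tight, all cells at `σ` are
  -- `k'`-cells and all cells at `τ` are `l'`-cells. Only the grouping changes.
  map_tight hφ := ⟨fun t => ⟨fun s => (hφ.1 s).1 t, fun σ => (hφ.2 σ).eval t⟩,
    fun τ => Cell.isCell_of_eval fun s => (hφ.1 s).2 τ⟩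

/-- Evaluating the transpose at `t` and then `s` is evaluating at `s` and then `t`, so the two cone
conditions differ only in the order of quantifiers. -/
theorem isModel_swapFunctor (hk : k' ≤ k) (hl : l' ≤ l) (h : k = l.bar) (h' : k' = l'.bar) :
    IsModel (Mod hk S (Mod hl T C)) (Mod hl T (Mod hk S C)) (swapFunctor hk hl h h' S T C) :=
  fun _ hc t s => hc s t

end Swap

/-! ### Extensionality up to heterogeneous equality, and involutivity of the transpose. -/

theorem LooseTrans.heq {k k' : Weakness} {hk : k' ≤ k} {S C : FCat.{u, u, u}}
    {M N M' N' : FFunctor S C} (hM : M = M') (hN : N = N') {φ : LooseTrans hk M N}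
    {ψ : LooseTrans hk M' N'} (h : ∀ x, HEq (φ.app x) (ψ.app x))
    (h' : ∀ {x y : S} (f : x ⟶ y), HEq (φ.cell f) (ψ.cell f)) : HEq φ ψ := by
  subst hM hN
  obtain ⟨a, c, _, _, _, _⟩ := φ
  obtain ⟨a', c', _, _, _, _⟩ := ψ
  obtain rfl : a = a' := funext fun x => eq_of_heq (h x)
  obtain rfl : @c = @c' := by
    funext x y f
    exact eq_of_heq (h' f)
  rfl

theorem Modification.heq {k k' : Weakness} {hk : k' ≤ k} {S C : FCat.{u, u, u}}
    {M N M' N' : FFunctor S C} (hM : M = M') (hN : N = N') {φ ψ : LooseTrans hk M N}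
    {φ' ψ' : LooseTrans hk M' N'} (hφ : HEq φ φ') (hψ : HEq ψ ψ') {μ : Modification φ ψ}
    {ν : Modification φ' ψ'} (h : ∀ x, HEq (μ.app x) (ν.app x)) : HEq μ ν := by
  subst hM hN hφ hψ
  exact heq_of_eq (Modification.ext (funext fun x => eq_of_heq (h x)))

theorem FFunctor.ext_heq {A : FCat.{w, v, u}} {B : FCat.{w₁, v₁, u₁}} {F G : FFunctor A B}
    (h : ∀ x, F.obj x = G.obj x) (h' : ∀ {x y : A} (f : x ⟶ y), HEq (F.map f) (G.map f))
    (h'' : ∀ {x y : A} {f g : x ⟶ y} (η : f ⟶ g), HEq (F.map₂ η) (G.map₂ η)) : F = G := by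
  obtain ⟨⟨⟨⟨⟨F, F'⟩, F''⟩, _, _⟩, _, _, _, _⟩, _⟩ := F
  obtain ⟨⟨⟨⟨⟨G, G'⟩, G''⟩, _, _⟩, _, _, _, _⟩, _⟩ := G
  obtain rfl : F = G := funext h
  obtain rfl : @F' = @G' := by
    funext x y f
    exact eq_of_heq (h' f)
  obtain rfl : @F'' = @G'' := by
    funext x y f g η
    exact eq_of_heq (h'' η)
  rfl

section Involutive

variable (h : k = l.bar) (h' : k' = l'.bar) (i : l = k.bar) (i' : l' = k'.bar)

/-- Reversing a cell twice returns its two directions unchanged, so all the data agree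
definitionally. The equality of objects is then transported through the heterogeneous statements
about morphisms and 2-cells. -/
theorem swapObj_swapObj (F : (Mod hk S (Mod hl T C)).cat) :
    swapObj i i' (swapObj h h' F) = F :=
  Subtype.ext (FFunctor.ext_heq (fun _ => rfl) (fun _ => HEq.rfl) fun _ => HEq.rfl)

variable {F G : (Mod hk S (Mod hl T C)).cat}

theorem app_swapHom_swapHom (φ : F ⟶ G) (s : S.cat) :
    HEq (Mod.app (swapHom i i' (swapHom h h' φ)) s) (Mod.app φ s) :=
  LooseTrans.heq rfl rfl (fun _ => HEq.rfl) fun _ => HEq.rfl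

theorem swapHom_swapHom (φ : F ⟶ G) : HEq (swapHom i i' (swapHom h h' φ)) φ :=
  LooseTrans.heq (congrArg Subtype.val (swapObj_swapObj h h' i i' F))
    (congrArg Subtype.val (swapObj_swapObj h h' i i' G))
    (app_swapHom_swapHom h h' i i' φ) fun _ => HEq.rfl

theorem swapHom₂_swapHom₂ {φ ψ : F ⟶ G} (μ : φ ⟶ ψ) :
    HEq (swapHom₂ i i' (swapHom₂ h h' μ)) μ :=
  Modification.heq (congrArg Subtype.val (swapObj_swapObj h h' i i' F))
    (congrArg Subtype.val (swapObj_swapObj h h' i i' G)) (swapHom_swapHom h h' i i' φ)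
    (swapHom_swapHom h h' i i' ψ) fun s =>
      Modification.heq rfl rfl (app_swapHom_swapHom h h' i i' φ s)
        (app_swapHom_swapHom h h' i i' ψ s) fun _ => HEq.rfl

theorem swapFunctor_comp_swapFunctor (hk : k' ≤ k) (hl : l' ≤ l) :
    (swapFunctor hk hl h h' S T C).comp (swapFunctor hl hk i i' T S C) = FFunctor.id _ :=
  FFunctor.ext_heq (swapObj_swapObj h h' i i') (swapHom_swapHom h h' i i')
    (swapHom₂_swapHom₂ h h' i i')

end Involutive

end Enhanced

theorem mainTheorem5 (w' w : Enhanced.Weakness) (h : w' ≤ w) (S T C : Enhanced.FSketch) :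
    Nonempty
      (Enhanced.Mod h S (Enhanced.Mod (Enhanced.Weakness.bar_mono h) T C) ≅
        Enhanced.Mod (Enhanced.Weakness.bar_mono h) T (Enhanced.Mod h S C)) :=
  -- This is `w = w.bar.bar`, which needs a case analysis; the inverse functor has the weaknesses
  -- exchanged and needs only `rfl`.
  have e := Enhanced.Weakness.eq_bar (rfl : w.bar = w.bar)
  have e' := Enhanced.Weakness.eq_bar (rfl : w'.bar = w'.bar)
  ⟨{ hom := ⟨Enhanced.swapFunctor _ _ e e' S T C, Enhanced.isModel_swapFunctor _ _ e e'⟩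
     inv := ⟨Enhanced.swapFunctor _ _ rfl rfl T S C, Enhanced.isModel_swapFunctor _ _ rfl rfl⟩
     hom_inv_id := Subtype.ext (Enhanced.swapFunctor_comp_swapFunctor e e' rfl rfl _ _)
     inv_hom_id := Subtype.ext (Enhanced.swapFunctor_comp_swapFunctor rfl rfl e e' _ _) }⟩
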